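/- Consider $n\ge 2$ mobile nodes in a square of side $L$. Initially the nodes are independent and uniformly distributed in the square. Each node moves at constant speed $v>0$; it changes direction at the points of a Poisson process of rate $\tau\ge 0$ (never if $\tau=0$), its initial and successive direction angles being uniform on $[0,2\pi)$; it is reflected at the borders of the square like a billiard ball; and all these random variables are independent, also between nodes. Let $R>0$ be the radio range. A meeting of two nodes begins when their distance becomes smaller than or equal to $R$, and its duration $T$ is the time during which the distance then stays smaller than or equal to $R$. For a time window $(0,h]$, $h>0$, and a set $D\subseteq[0,\infty]$, let $P(T\in D)$ be the expected number of meetings (between any two of the $n$ nodes) that begin in the window and have duration in $D$, divided by the expected number of all meetings that begin in the window. Then, in the limit of a large domain ($n,L\to\infty$ with $R$ and $v$ fixed), the duration of a meeting satisfies $$P(T>t)\;\le\;P(T\ge t)\;\le\;\min\Bigl(1,\frac{\pi^2R}{8vt}\Bigr)\qquad(t>0)$$ in the following sense: for every $\varepsilon>0$ there is $L_0>0$, depending only on $v,R,\varepsilon$, such that for all $L\ge L_0$, $n\ge 2$, $\tau\ge 0$, $h>0$, the expected number of meetings that begin in $(0,h]$ is positive and finite, and for all $t>0$ both $P(T>t)$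 and $P(T\ge t)$ are at most $\min\bigl(1,\frac{\pi^2R}{8vt}\bigr)+\varepsilon$. -/

import Mathlib

open MeasureTheory ProbabilityTheory
open scoped ENNReal NNReal Topology

namespace MobileNetwork

noncomputable section

/-! ### The mobility of one node -/

/-- The plane with its Euclidean distance. -/
abbrev Plane : Type := EuclideanSpace ℝ (Fin 2)

/-- The network domain, a square of side `L`. -/
def square (L : ℝ) : Set Plane := {x | ∀ i, x i ∈ Set.Icc 0 L}

/-- The uniform law of a direction angle on `[0, 2π)`. -/
def directionLaw : Measure ℝ := volume[|Set.Ico 0 (2 * Real.pi)]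

/-- The exponential law of rate one, the law of the gaps of a unit-rate Poisson process. -/
def gapLaw : Measure ℝ := expMeasure 1

instance : IsProbabilityMeasure directionLaw := by
  refine cond_isProbabilityMeasure_of_finite ?_ ?_
  · simp [Real.volume_Ico, Real.pi_pos]
  · rw [Real.volume_Ico]; exact ENNReal.ofReal_ne_top

instance : IsProbabilityMeasure gapLaw := isProbabilityMeasure_expMeasure one_pos

/-- The randomness of one node: its initial position, the sequence of its direction angles, and
the sequence of the gaps of a unit-rate Poisson process. -/
abbrev NodeSample : Type := Plane × (ℕ → ℝ) × (ℕ → ℝ)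

/-- The law of one node: the initial position is uniform on the square of side `L`, the direction
angles are independent and uniform on `[0, 2π)`, the gaps are independent and exponential of rate
one, and the three are independent. -/
def nodeLaw (L : ℝ) : Measure NodeSample :=
  (volume[|square L]).prod
    ((Measure.infinitePi fun _ : ℕ => directionLaw).prod
      (Measure.infinitePi fun _ : ℕ => gapLaw))

/-- The law of `n` independent, identically distributed nodes. -/
def networkLaw (n : ℕ) (L : ℝ) : Measure (Fin n → NodeSample) :=
  Measure.pi fun _ => nodeLaw L

/-- The number of direction changes up to time `s`, when changes occur at Poisson rate `τ`: the
`k`-th change happens when `τ * s` reaches the sum of the first `k` gaps. There is no change when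
`τ = 0`. -/
def changes (τ : ℝ) (gap : ℕ → ℝ) (s : ℝ) : ℕ :=
  sInf {k | τ * s < ∑ i ∈ Finset.range (k + 1), gap i}

/-- The unit vector of a direction angle. -/
def heading (θ : ℝ) : Plane := !₂[Real.cos θ, Real.sin θ]

/-- The trajectory of a node before reflection: it starts at the initial position and moves with
speed `v` in the direction that was chosen at the last direction change. -/
def freePath (v τ : ℝ) (ω : NodeSample) (t : ℝ) : Plane :=
  ω.1 + ∫ s in (0 : ℝ)..t, v • heading (ω.2.1 (changes τ ω.2.2 s))

/-- The reflection of the line into `[0, L]` at its two end points: the distance of `x` to the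
nearest multiple of `2 * L` (a triangle wave, equal to `x` for `x` in `[0, L]`). -/
def fold (L x : ℝ) : ℝ := |x - 2 * L * round (x / (2 * L))|

/-- The trajectory of a node in the square: the free trajectory reflected at the borders, like a
billiard ball. Each coordinate is folded into `[0, L]`, so that between direction changes the node
keeps its speed `v` and is reflected specularly at every border it hits. -/
def path (L v τ : ℝ) (ω : NodeSample) (t : ℝ) : Plane :=
  WithLp.toLp 2 fun i => fold L (freePath v τ ω t i)

/-! ### Meetings -/

/-- A meeting of two moving points begins at time `s`: their distance becomes smaller than or
equal to `R` at time `s`, having been larger than `R` just before. -/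
def MeetingBegins (R : ℝ) (a b : ℝ → Plane) (s : ℝ) : Prop :=
  dist (a s) (b s) ≤ R ∧ ∀ᶠ u in 𝓝[<] s, R < dist (a u) (b u)

/-- The duration of a meeting that begins at time `s`: the length of the longest time interval
starting at `s` during which the distance stays smaller than or equal to `R`. -/
def meetingDuration (R : ℝ) (a b : ℝ → Plane) (s : ℝ) : ℝ≥0∞ :=
  ⨆ (u : ℝ≥0) (_ : ∀ r ∈ Set.Icc s (s + u), dist (a r) (b r) ≤ R), (u : ℝ≥0∞)

/-- The expected number of meetings, between any two of the `n` nodes, that begin in the time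
window `(0, h]` and whose duration belongs to `D`. -/
def expectedMeetings (n : ℕ) (L v τ R h : ℝ) (D : Set ℝ≥0∞) : ℝ≥0∞ :=
  ∫⁻ ω, ∑ i, ∑ j ∈ Finset.Ioi i,
    (Set.encard {s : ℝ | s ∈ Set.Ioc 0 h ∧
      MeetingBegins R (path L v τ (ω i)) (path L v τ (ω j)) s ∧
      meetingDuration R (path L v τ (ω i)) (path L v τ (ω j)) s ∈ D} : ℝ≥0∞) ∂networkLaw n L

/-- The probability `P(T ∈ D)` that the duration `T` of a meeting belongs to `D`: among the
meetings that begin in the time window `(0, h]`, the expected number of those with duration in `D`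
over the expected number of all. -/
def meetingProb (n : ℕ) (L v τ R h : ℝ) (D : Set ℝ≥0∞) : ℝ≥0∞ :=
  expectedMeetings n L v τ R h D / expectedMeetings n L v τ R h Set.univ

end

end MobileNetwork

/-!
The bound is Markov's inequality for a stationary process. The law of a node (`nodeLaw`: uniform
position, independent uniform headings, independent exponential gaps) is invariant under the passage
of time (`measurePreserving_shiftNode`): the Poisson clock has no memory (`measurePreserving_renew`),
the headings to come are again independent and uniform, also after being reflected
(`measurePreserving_reflectSeq`), and the billiard flow in the square preserves the product of
Lebesgue measure and the counting measure on the signs of the velocity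
(`measurePreserving_billiard`). Because the displacement of a node and its present heading are
dependent, the position alone is not enough here: the phase space carries the signs, and the
invariance of the law under reflections of all headings allows the signs to be added and removed
(`measurePreserving_unphase`).

Numerator. A meeting of duration at least `t` contains exactly one multiple of `t` among the times
`[s, s + t)` after its beginning `s`, and different meetings contain different ones. So in a long
window of length `m h` the number of such meetings is at most the number of multiples of `t` at which
the two nodes are within distance `R`; each of these has probability at most `π R² / L²`. By
stationarity the window `(0, h]` contributes at most the `m`-th part, and `m → ∞` gives
`expectedMeetings_Ici_le`.

Denominator. By stationarity again, `(0, h]` may be cut into `m` short windows of length `δ`. In a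
short window two nodes that do not turn and stay away from the border move uniformly, and a meeting
begins if the relative position lies in a region of area `2 R δ` times the relative speed
(`volume_sweep`). The mean relative speed is `4 v / π` (`lintegral_relVelocity`), and `δ → 0` gives
`le_expectedMeetings_univ`. The quotient of the two bounds is `π² R / (8 v t)` times
`L² / (L - 2 R)²`, uniformly in `n`, `τ` and `h`.

Finiteness. Between two beginnings at which both nodes have the same number of direction changes and
the same lattice cells, the motion is uniform and the distance convex, which excludes a second
beginning (`injOn_nodeCode`). So the number of meetings is bounded by the number of such codes, which
is controlled by the second moments of the Poisson numbers of direction changes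
(`lintegral_count_sq_ne_top`).

The number of meetings is not shown to be a measurable function of the sample. The lower Lebesgue
integral in `expectedMeetings` is superadditive and does not decrease when a measure-preserving map is
pulled back, and these two facts are all that the argument uses.
-/

namespace MobileNetwork

noncomputable section

/-! ### Folding the line onto `[0, L]` -/

theorem fold_neg {L : ℝ} (hL : 0 < L) (x : ℝ) : fold L (-x) = fold L x := by
  have key : ∀ y : ℝ, fold L (-y) ≤ fold L y := by
    intro y
    have h1 : ∀ z : ℝ, ∀ k : ℤ, |z - 2 * L * k| = 2 * L * |z / (2 * L) - k| := by
      intro z k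
      rw [← abs_of_pos (show 0 < 2 * L by positivity), ← abs_mul,
        abs_of_pos (show 0 < 2 * L by positivity)]
      congr 1
      field_simp
    unfold fold
    rw [h1, h1]
    refine mul_le_mul_of_nonneg_left ?_ (by positivity)
    refine (round_le _ (-round (y / (2 * L)))).trans (le_of_eq ?_)
    rw [← abs_neg]
    congr 1
    push_cast
    ring
  refine le_antisymm (key x) ?_
  simpa using key (-x)

theorem fold_add_period {L : ℝ} (hL : 0 < L) (x : ℝ) (k : ℤ) :
    fold L (x + 2 * L * k) = fold L x := by
  unfold fold
  have : (x + 2 * L * k) / (2 * L) = x / (2 * L) + k := by field_simp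
  rw [this, round_add_intCast]
  congr 1
  push_cast
  ring

theorem fold_of_mem {L : ℝ} (hL : 0 < L) {x : ℝ} (hx : x ∈ Set.Icc 0 L) : fold L x = x := by
  have h0 : 0 ≤ x / (2 * L) := div_nonneg hx.1 (by positivity)
  have h1 : x / (2 * L) ≤ 1 / 2 := by
    rw [div_le_div_iff₀ (by positivity) (by norm_num)]; linarith [hx.2]
  have h2 : fold L x = 2 * L * |x / (2 * L) - round (x / (2 * L))| := by
    unfold fold
    rw [← abs_of_pos (show 0 < 2 * L by positivity), ← abs_mul,
      abs_of_pos (show 0 < 2 * L by positivity)]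
    congr 1
    field_simp
  rw [h2, abs_sub_round_eq_min, Int.fract_eq_self.2 ⟨h0, by linarith⟩, min_eq_left (by linarith)]
  field_simp

/-- The orientation of the folding map at `x`: `1` where it is increasing and `-1` where it is
decreasing. -/
def foldSign (L x : ℝ) : ℝ := if Even ⌊x / L⌋ then 1 else -1

theorem foldSign_mul_self (L x : ℝ) : foldSign L x * foldSign L x = 1 := by
  unfold foldSign; split_ifs <;> norm_num

theorem foldSign_eq_or (L x : ℝ) : foldSign L x = 1 ∨ foldSign L x = -1 := by
  unfold foldSign; split_ifs <;> simp

theorem fold_of_even_floor {L : ℝ} (hL : 0 < L) {x : ℝ} (h : Even ⌊x / L⌋) :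
    fold L x = x - L * ⌊x / L⌋ ∧ fold L x ∈ Set.Icc 0 L := by
  obtain ⟨k, hk⟩ := h
  have h1 := Int.floor_le (x / L)
  have h2 := Int.lt_floor_add_one (x / L)
  rw [le_div_iff₀ hL] at h1
  rw [div_lt_iff₀ hL] at h2
  have hm : x - L * ⌊x / L⌋ ∈ Set.Icc 0 L := ⟨by linarith, by linarith⟩
  have : fold L x = x - L * ⌊x / L⌋ := by
    rw [← fold_of_mem hL hm, ← fold_add_period hL (x - L * ⌊x / L⌋) k]
    congr 1
    rw [hk]; push_cast; ring
  exact ⟨this, this ▸ hm⟩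

theorem fold_of_not_even_floor {L : ℝ} (hL : 0 < L) {x : ℝ} (h : ¬ Even ⌊x / L⌋) :
    fold L x = L * (⌊x / L⌋ + 1) - x ∧ fold L x ∈ Set.Icc 0 L := by
  obtain ⟨k, hk⟩ := Int.not_even_iff_odd.1 h
  have h1 := Int.floor_le (x / L)
  have h2 := Int.lt_floor_add_one (x / L)
  rw [le_div_iff₀ hL] at h1
  rw [div_lt_iff₀ hL] at h2
  have hm : L * (⌊x / L⌋ + 1) - x ∈ Set.Icc 0 L := ⟨by linarith, by linarith⟩
  have : fold L x = L * (⌊x / L⌋ + 1) - x := by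
    rw [← fold_of_mem hL hm, ← fold_neg hL x, ← fold_add_period hL (-x) (k + 1)]
    congr 1
    rw [hk]; push_cast; ring
  exact ⟨this, this ▸ hm⟩

theorem exists_eq_foldSign_mul_fold {L : ℝ} (hL : 0 < L) (x : ℝ) :
    ∃ k : ℤ, x = foldSign L x * fold L x + 2 * L * k := by
  unfold foldSign
  split_ifs with h
  · obtain ⟨k, hk⟩ := id h
    refine ⟨k, ?_⟩
    rw [(fold_of_even_floor hL h).1, hk]; push_cast; ring
  · obtain ⟨k, hk⟩ := Int.not_even_iff_odd.1 h
    refine ⟨k + 1, ?_⟩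
    rw [(fold_of_not_even_floor hL h).1, hk]; push_cast; ring

/-- Folding after a displacement: fold the starting point first, and displace the folded point by
the displacement, reversed if the folding map is decreasing there. -/
theorem fold_add {L : ℝ} (hL : 0 < L) (x S : ℝ) :
    fold L (x + S) = fold L (fold L x + foldSign L x * S) := by
  obtain ⟨k, hk⟩ := exists_eq_foldSign_mul_fold hL x
  have h1 : x + S = foldSign L x * (fold L x + foldSign L x * S) + 2 * L * k := by
    have := foldSign_mul_self L x
    linear_combination hk - S * this
  rw [h1, fold_add_period hL]
  rcases foldSign_eq_or L x with h | h <;> rw [h]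
  · simp
  · rw [neg_one_mul, fold_neg hL]

/-- The folding map is affine between consecutive multiples of `L`. -/
theorem fold_convex_comb {L : ℝ} (hL : 0 < L) {x y a b : ℝ} (hxy : ⌊x / L⌋ = ⌊y / L⌋)
    (ha : 0 ≤ a) (hb : 0 ≤ b) (hab : a + b = 1) :
    fold L (a * x + b * y) = a * fold L x + b * fold L y := by
  have hx1 := Int.floor_le (x / L)
  have hx2 := Int.lt_floor_add_one (x / L)
  have hy1 := Int.floor_le (y / L)
  have hy2 := Int.lt_floor_add_one (y / L)
  rw [← hxy] at hy1 hy2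
  have hz : ⌊(a * x + b * y) / L⌋ = ⌊x / L⌋ := by
    rw [Int.floor_eq_iff]
    have e : (a * x + b * y) / L = a * (x / L) + b * (y / L) := by ring
    rw [e]
    obtain rfl : b = 1 - a := by linarith
    constructor
    · nlinarith
    · rcases ha.eq_or_lt with h | h
      · rw [← h]; linarith
      · nlinarith
  by_cases h : Even ⌊x / L⌋
  · have hy : Even ⌊y / L⌋ := by rwa [← hxy]
    have hz' : Even ⌊(a * x + b * y) / L⌋ := by rwa [hz]
    rw [(fold_of_even_floor hL h).1, (fold_of_even_floor hL hy).1,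
      (fold_of_even_floor hL hz').1, hz, ← hxy]
    linear_combination L * ⌊x / L⌋ * hab
  · have hy : ¬ Even ⌊y / L⌋ := by rwa [← hxy]
    have hz' : ¬ Even ⌊(a * x + b * y) / L⌋ := by rwa [hz]
    rw [(fold_of_not_even_floor hL h).1, (fold_of_not_even_floor hL hy).1,
      (fold_of_not_even_floor hL hz').1, hz, ← hxy]
    linear_combination -L * (⌊x / L⌋ + 1) * hab

@[fun_prop]
theorem measurable_fold (L : ℝ) : Measurable (fold L) := by
  unfold fold
  simp only [round_eq]
  have : Measurable fun x : ℝ => ((⌊x / (2 * L) + 1 / 2⌋ : ℤ) : ℝ) :=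
    measurable_from_top.comp (Int.measurable_floor.comp (by fun_prop))
  have h2 : Measurable fun x : ℝ => x - 2 * L * ((⌊x / (2 * L) + 1 / 2⌋ : ℤ) : ℝ) := by fun_prop
  exact (continuous_abs.measurable).comp h2

@[fun_prop]
theorem measurable_foldSign (L : ℝ) : Measurable (foldSign L) :=
  (measurable_from_top (f := fun k : ℤ => if Even k then (1 : ℝ) else -1)).comp
    (Int.measurable_floor.comp (by fun_prop : Measurable fun x : ℝ => x / L))

theorem foldSign_add_period {L : ℝ} (hL : 0 < L) (x : ℝ) (k : ℤ) :
    foldSign L (x + 2 * L * k) = foldSign L x := by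
  unfold foldSign
  have : (x + 2 * L * k) / L = x / L + ((2 * k : ℤ) : ℝ) := by push_cast; field_simp
  rw [this, Int.floor_add_intCast]
  simp [Int.even_add]

theorem foldSign_neg {L x : ℝ} (hx : ∀ k : ℤ, (k : ℝ) ≠ x / L) :
    foldSign L (-x) = -foldSign L x := by
  unfold foldSign
  have h1 : ⌊-x / L⌋ = -⌊x / L⌋ - 1 := by
    rw [Int.floor_eq_iff]
    have a := Int.floor_le (x / L)
    have b := Int.lt_floor_add_one (x / L)
    have c := lt_of_le_of_ne a (hx _)
    rw [neg_div]
    push_cast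
    constructor <;> linarith
  rw [h1]
  by_cases h : Even ⌊x / L⌋
  · simp [h]
  · simp [h]

theorem foldSign_of_mem {L : ℝ} {x : ℝ} (hx : x ∈ Set.Ico 0 L) : foldSign L x = 1 := by
  have hL : 0 < L := hx.1.trans_lt hx.2
  have : ⌊x / L⌋ = 0 := by
    rw [Int.floor_eq_zero_iff]
    exact ⟨div_nonneg hx.1 hL.le, (div_lt_one hL).2 hx.2⟩
  simp [foldSign, this]

/-! ### Billiard invariance -/

/-- The integral of a periodic function over a period does not depend on where the period starts. -/
theorem lintegral_Ioc_periodic {T : ℝ} (hT : 0 < T) {F : ℝ → ℝ≥0∞} (hF : Function.Periodic F T)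
    (a b : ℝ) : ∫⁻ x in Set.Ioc a (a + T), F x = ∫⁻ x in Set.Ioc b (b + T), F x := by
  have : VAddInvariantMeasure (AddSubgroup.zmultiples T) ℝ volume :=
    ⟨fun c s _ => measure_preimage_add _ _ _⟩
  exact (isAddFundamentalDomain_Ioc hT a).setLIntegral_eq (isAddFundamentalDomain_Ioc hT b) F
    hF.map_vadd_zmultiples

theorem lintegral_Ioc_periodic_add {T : ℝ} (hT : 0 < T) {F : ℝ → ℝ≥0∞}
    (hF : Function.Periodic F T) (a b S : ℝ) :
    ∫⁻ x in Set.Ioc a (a + T), F (x + S) = ∫⁻ x in Set.Ioc b (b + T), F x := by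
  have hF' : Function.Periodic (fun x => F (x + S)) T := by
    intro x
    show F (x + T + S) = F (x + S)
    rw [add_right_comm, hF]
  rw [lintegral_Ioc_periodic hT hF' a (b - S),
    ← (measurePreserving_add_right volume S).setLIntegral_comp_preimage_emb
      (measurableEmbedding_addRight S) F]
  congr 2
  ext x
  simp only [Set.mem_preimage, Set.mem_Ioc]
  constructor <;> rintro ⟨h1, h2⟩ <;> constructor <;> linarith

theorem lintegral_Ioc_neg (F : ℝ → ℝ≥0∞) (a b : ℝ) :
    ∫⁻ x in Set.Ioc a b, F (-x) = ∫⁻ x in Set.Ioc (-b) (-a), F x := by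
  rw [← (Measure.measurePreserving_neg (volume : Measure ℝ)).setLIntegral_comp_preimage_emb
      (MeasurableEquiv.neg ℝ).measurableEmbedding F]
  have : (MeasurableEquiv.neg ℝ : ℝ → ℝ) = Neg.neg := rfl
  refine setLIntegral_congr ?_
  have e : Neg.neg ⁻¹' Set.Ioc (-b) (-a) = Set.Ico a b := by
    ext x; simp only [Set.mem_preimage, Set.mem_Ioc, Set.mem_Ico]
    constructor <;> rintro ⟨h1, h2⟩ <;> constructor <;> linarith
  rw [e]
  exact Ico_ae_eq_Ioc.symm

/-- The counting measure on the two signs `1` and `-1`, as a measure on `ℝ` of total mass `2`. -/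
def signMeasure : Measure ℝ := Measure.dirac 1 + Measure.dirac (-1)

instance : IsFiniteMeasure signMeasure := by unfold signMeasure; infer_instance

/-- The phase space measure of a point that moves on `[0, L]`: position and sign of the
velocity. -/
def phaseMeasure (L : ℝ) : Measure (ℝ × ℝ) := (volume.restrict (Set.Icc 0 L)).prod signMeasure

instance (L : ℝ) : IsFiniteMeasure (phaseMeasure L) := by unfold phaseMeasure; infer_instance

theorem lintegral_phaseMeasure (L : ℝ) {f : ℝ × ℝ → ℝ≥0∞} (hf : Measurable f) :
    ∫⁻ p, f p ∂phaseMeasure L =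
      (∫⁻ x in Set.Ioc 0 L, f (x, 1)) + ∫⁻ x in Set.Ioc 0 L, f (x, -1) := by
  have e : (volume.restrict (Set.Icc 0 L) : Measure ℝ) = volume.restrict (Set.Ioc 0 L) :=
    Measure.restrict_congr_set Ioc_ae_eq_Icc.symm
  rw [phaseMeasure, signMeasure, Measure.prod_add, lintegral_add_measure, Measure.prod_dirac,
    Measure.prod_dirac, lintegral_map hf (by fun_prop), lintegral_map hf (by fun_prop), e]

/-- The motion of a point on `[0, L]`: a displacement by `S` in the direction of the sign, with
reflection at the end points. -/
def billiard (L S : ℝ) (p : ℝ × ℝ) : ℝ × ℝ :=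
  (fold L (p.1 + p.2 * S), foldSign L (p.1 + p.2 * S) * p.2)

theorem ae_ne_intCast_div {L : ℝ} (hL : 0 < L) (S : ℝ) :
    ∀ᵐ x : ℝ, ∀ k : ℤ, (k : ℝ) ≠ (x + S) / L := by
  have : (Set.range fun k : ℤ => (k : ℝ) * L - S).Countable := Set.countable_range _
  filter_upwards [this.ae_notMem volume] with x hx k hk
  refine hx ⟨k, ?_⟩
  simp only [hk]
  field_simp
  ring

/-- The two signs together unfold the motion on `[0, L]` to a translation of the circle of length
`2 L`: the motion with sign `-1` is the mirror image of a motion that starts in `[-L, 0]`. -/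
theorem lintegral_billiard {L : ℝ} (hL : 0 < L) (S : ℝ) {f : ℝ × ℝ → ℝ≥0∞} (hf : Measurable f) :
    ∫⁻ p, f (billiard L S p) ∂phaseMeasure L =
      ∫⁻ x in Set.Ioc (-L) L, f (fold L x, foldSign L x) := by
  have hm : Measurable (billiard L S) := by unfold billiard; fun_prop
  rw [lintegral_phaseMeasure L (f := fun p => f (billiard L S p)) (hf.comp hm)]
  set F : ℝ → ℝ≥0∞ := fun x => f (fold L x, foldSign L x) with hFdef
  have hF : Function.Periodic F (2 * L) := by
    intro x
    have h1 := fold_add_period hL x 1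
    have h2 := foldSign_add_period hL x 1
    simp only [Int.cast_one, mul_one] at h1 h2
    simp only [hFdef, h1, h2]
  have e1 : ∀ x, f (billiard L S (x, 1)) = F (x + S) := by
    intro x; simp [billiard, hFdef]
  -- The signs at `x` and `-x` are opposite except at multiples of `L`, hence only almost everywhere.
  have e2 : ∫⁻ x in Set.Ioc 0 L, f (billiard L S (x, -1)) =
      ∫⁻ x in Set.Ioc (-L) 0, F (x + S) := by
    have := lintegral_Ioc_neg (fun x => F (x + S)) 0 L
    rw [neg_zero] at this
    rw [← this]
    refine lintegral_congr_ae (ae_restrict_of_ae ?_)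
    filter_upwards [ae_ne_intCast_div hL (-S)] with x hx
    have hx' := foldSign_neg hx
    have hx'' := fold_neg hL (x + -S)
    have : -x + S = -(x + -S) := by ring
    simp only [billiard, hFdef, this, hx', hx'']
    simp
  simp only [e1, e2]
  rw [add_comm, ← lintegral_union measurableSet_Ioc (by
      rw [Set.Ioc_disjoint_Ioc]; simp [hL.le]), Set.Ioc_union_Ioc_eq_Ioc (by linarith) hL.le]
  have := lintegral_Ioc_periodic_add (T := 2 * L) (by linarith) hF (-L) (-L) S
  have e3 : -L + 2 * L = L := by ring
  rwa [e3] at this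

/-- Liouville's theorem for the billiard on `[0, L]`. -/
theorem measurePreserving_billiard {L : ℝ} (hL : 0 < L) (S : ℝ) :
    MeasurePreserving (billiard L S) (phaseMeasure L) (phaseMeasure L) := by
  have hm : Measurable (billiard L S) := by unfold billiard; fun_prop
  refine ⟨hm, Measure.ext_of_lintegral _ fun f hf => ?_⟩
  -- The unfolded integral does not depend on `S`, and for `S = 0` the motion is trivial.
  rw [lintegral_map hf hm, lintegral_billiard hL S hf, ← lintegral_billiard hL 0 hf,
    lintegral_phaseMeasure L hf, lintegral_phaseMeasure L (f := fun p => f (billiard L 0 p))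
      (hf.comp (by unfold billiard; fun_prop))]
  have : ∀ c : ℝ, ∫⁻ x in Set.Ioc 0 L, f (billiard L 0 (x, c)) =
      ∫⁻ x in Set.Ioc 0 L, f (x, c) := by
    intro c
    have e : (volume.restrict (Set.Ioc 0 L) : Measure ℝ) = volume.restrict (Set.Ioo 0 L) :=
      Measure.restrict_congr_set Ioo_ae_eq_Ioc.symm
    rw [e]
    refine setLIntegral_congr_fun measurableSet_Ioo fun x hx => ?_
    simp [billiard, fold_of_mem hL ⟨hx.1.le, hx.2.le⟩, foldSign_of_mem ⟨hx.1.le, hx.2⟩]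
  rw [this, this]

/-! ### Independent identically distributed sequences -/

/-- The law of an i.i.d. sequence of real random variables. -/
abbrev iidLaw (μ : Measure ℝ) [IsProbabilityMeasure μ] : Measure (ℕ → ℝ) :=
  Measure.infinitePi fun _ : ℕ => μ

/-- The sequence with first term `y` followed by the sequence `g`. -/
def consSeq (y : ℝ) (g : ℕ → ℝ) : ℕ → ℝ
  | 0 => y
  | n + 1 => g n

theorem measurable_consSeq : Measurable fun p : ℝ × (ℕ → ℝ) => consSeq p.1 p.2 := by
  refine measurable_pi_iff.2 fun n => ?_
  cases n with
  | zero => exact measurable_fst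
  | succ n => exact (measurable_pi_apply n).comp measurable_snd

/-- An independent first term in front of an i.i.d. sequence yields an i.i.d. sequence. -/
theorem measurePreserving_consSeq (μ : Measure ℝ) [IsProbabilityMeasure μ] :
    MeasurePreserving (fun p : ℝ × (ℕ → ℝ) => consSeq p.1 p.2) (μ.prod (iidLaw μ)) (iidLaw μ) := by
  refine ⟨measurable_consSeq, Measure.eq_infinitePi _ fun s t ht => ?_⟩
  classical
  set t' : ℕ → Set ℝ := fun i => if i ∈ s then t i else Set.univ with ht'
  have hmt' : ∀ i, MeasurableSet (t' i) := by
    intro i; simp only [ht']; split_ifs; exacts [ht i, MeasurableSet.univ]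
  obtain ⟨N, hN⟩ : ∃ N, s ⊆ Finset.range (N + 1) :=
    ⟨s.sup id, fun i hi => Finset.mem_range.2 (Nat.lt_succ_of_le (Finset.le_sup (f := id) hi))⟩
  have h1 : (fun p : ℝ × (ℕ → ℝ) => consSeq p.1 p.2) ⁻¹' (Set.pi s t) =
      t' 0 ×ˢ Set.pi (Finset.range N) (fun i => t' (i + 1)) := by
    ext ⟨y, g⟩
    simp only [Set.mem_preimage, Set.mem_pi, Set.mem_prod, Finset.mem_coe, ht']
    constructor
    · intro h
      refine ⟨?_, fun i _ => ?_⟩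
      · split_ifs with h0
        · exact h 0 h0
        · trivial
      · split_ifs with h0
        · exact h (i + 1) h0
        · trivial
    · rintro ⟨h0, h⟩ i hi
      cases i with
      | zero => simpa [hi, consSeq] using h0
      | succ i =>
        have := h i (by have := hN hi; simp at this ⊢; omega)
        simpa [hi, consSeq] using this
  have h2 : ∏ i ∈ s, μ (t i) = ∏ i ∈ Finset.range (N + 1), μ (t' i) := by
    rw [← Finset.prod_subset hN (fun i _ hi => by simp [ht', hi])]
    exact Finset.prod_congr rfl fun i hi => by simp [ht', hi]
  rw [Measure.map_apply measurable_consSeq (MeasurableSet.pi s.countable_toSet fun i _ => ht i),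
    h1, Measure.prod_prod, Measure.infinitePi_pi _ (fun i _ => hmt' _), h2,
    Finset.prod_range_succ', mul_comm]

theorem measurePreserving_shiftSeq (μ : Measure ℝ) [IsProbabilityMeasure μ] (k : ℕ) :
    MeasurePreserving (fun (θ : ℕ → ℝ) n => θ (k + n)) (iidLaw μ) (iidLaw μ) := by
  have hm : Measurable fun (θ : ℕ → ℝ) n => θ (k + n) := by fun_prop
  refine ⟨hm, Measure.eq_infinitePi _ fun s t ht => ?_⟩
  have h1 : (fun (θ : ℕ → ℝ) n => θ (k + n)) ⁻¹' (Set.pi s t) =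
      Set.pi (s.map (addLeftEmbedding k)) (fun i => t (i - k)) := by
    ext θ
    simp [Set.mem_pi]
  rw [Measure.map_apply hm (MeasurableSet.pi s.countable_toSet fun i _ => ht i), h1,
    Measure.infinitePi_pi _ (fun i _ => ht _), Finset.prod_map]
  simp

/-! ### The exponential law -/

theorem lintegral_gapLaw {f : ℝ → ℝ≥0∞} (hf : Measurable f) :
    ∫⁻ x, f x ∂gapLaw = ∫⁻ x in Set.Ioi 0, ENNReal.ofReal (Real.exp (-x)) * f x := by
  have h1 : gapLaw = volume.withDensity (exponentialPDF 1) := rfl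
  have hm : Measurable (exponentialPDF 1) :=
    (measurable_exponentialPDFReal 1).ennreal_ofReal
  rw [h1, lintegral_withDensity_eq_lintegral_mul _ hm hf,
    ← lintegral_add_compl _ (measurableSet_Ici (a := (0 : ℝ)))]
  have h2 : ∫⁻ x in (Set.Ici (0 : ℝ))ᶜ, (exponentialPDF 1 * f) x = 0 := by
    rw [setLIntegral_congr_fun (g := fun _ => 0) measurableSet_Ici.compl]
    · simp
    · intro x hx
      simp only [Set.mem_compl_iff, Set.mem_Ici, not_le] at hx
      simp [exponentialPDF_of_neg hx]
  rw [h2, add_zero, setLIntegral_congr Ioi_ae_eq_Ici.symm]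
  refine setLIntegral_congr_fun measurableSet_Ioi fun x hx => ?_
  simp [exponentialPDF_of_nonneg (le_of_lt hx)]

/-- The exponential law has no memory. -/
theorem map_sub_restrict_gapLaw {c : ℝ} (hc : 0 ≤ c) :
    (gapLaw.restrict (Set.Ioi c)).map (fun y => y - c) =
      ENNReal.ofReal (Real.exp (-c)) • gapLaw := by
  refine Measure.ext_of_lintegral _ fun f hf => ?_
  have hf' : Measurable fun y => f (y - c) := hf.comp (by fun_prop)
  rw [lintegral_map hf (by fun_prop), lintegral_smul_measure, lintegral_gapLaw hf,
    ← lintegral_indicator measurableSet_Ioi, lintegral_gapLaw (hf'.indicator measurableSet_Ioi),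
    smul_eq_mul, ← lintegral_const_mul _ (by fun_prop)]
  have h1 := (measurePreserving_sub_right volume c).setLIntegral_comp_preimage_emb
    (measurableEmbedding_subRight c) (fun x => ENNReal.ofReal (Real.exp (-c)) *
      (ENNReal.ofReal (Real.exp (-x)) * f x)) (Set.Ioi 0)
  have h2 : (fun x : ℝ => x - c) ⁻¹' Set.Ioi 0 = Set.Ioi c := by ext x; simp
  have h3 : ∀ x, ENNReal.ofReal (Real.exp (-x)) * (Set.Ioi c).indicator (fun y => f (y - c)) x =
      (Set.Ioi c).indicator (fun x => ENNReal.ofReal (Real.exp (-c)) *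
        (ENNReal.ofReal (Real.exp (-(x - c))) * f (x - c))) x := by
    intro x
    by_cases hx : x ∈ Set.Ioi c
    · rw [Set.indicator_of_mem hx, Set.indicator_of_mem hx, ← mul_assoc,
        ← ENNReal.ofReal_mul (Real.exp_nonneg _), ← Real.exp_add]
      congr 3; ring
    · rw [Set.indicator_of_notMem hx, Set.indicator_of_notMem hx, mul_zero]
  simp only [h3]
  rw [← h1, h2, setLIntegral_indicator measurableSet_Ioi,
    Set.inter_eq_left.2 (Set.Ioi_subset_Ioi hc)]

theorem gapLaw_Ioi {c : ℝ} (hc : 0 ≤ c) :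
    gapLaw (Set.Ioi c) = ENNReal.ofReal (Real.exp (-c)) := by
  have := congrArg (fun m => m Set.univ) (map_sub_restrict_gapLaw hc)
  simpa [Measure.map_apply (show Measurable fun y : ℝ => y - c by fun_prop) MeasurableSet.univ]
    using this

theorem lintegral_exp_neg_gapLaw : ∫⁻ y, ENNReal.ofReal (Real.exp (-y)) ∂gapLaw = 2⁻¹ := by
  have h := lintegral_exponentialPDF_eq_one (r := 2) two_pos
  rw [← lintegral_add_compl _ (measurableSet_Ici (a := (0 : ℝ)))] at h
  have h2 : ∫⁻ x in (Set.Ici (0 : ℝ))ᶜ, exponentialPDF 2 x = 0 := by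
    rw [setLIntegral_congr_fun (g := fun _ => 0) measurableSet_Ici.compl]
    · simp
    · intro x hx
      simp only [Set.mem_compl_iff, Set.mem_Ici, not_le] at hx
      simp [exponentialPDF_of_neg hx]
  rw [h2, add_zero, setLIntegral_congr Ioi_ae_eq_Ici.symm,
    setLIntegral_congr_fun (g := fun x => 2 * (ENNReal.ofReal (Real.exp (-x)) *
      ENNReal.ofReal (Real.exp (-x)))) measurableSet_Ioi, lintegral_const_mul _ (by fun_prop)] at h
  · rw [lintegral_gapLaw (by fun_prop)]
    exact ENNReal.eq_inv_of_mul_eq_one_left (by rwa [mul_comm])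
  · intro x hx
    simp only [exponentialPDF_of_nonneg (le_of_lt hx)]
    rw [← ENNReal.ofReal_mul (Real.exp_nonneg _), ← Real.exp_add,
      ENNReal.ofReal_mul (by norm_num)]
    norm_num
    ring_nf

/-! ### The Poisson clock -/

/-- The number of points in `[0, c]` of the unit-rate Poisson process with gaps `g`, with the value
`0` if all points lie in `[0, c]`. -/
def count (g : ℕ → ℝ) (c : ℝ) : ℕ := sInf {k | c < ∑ i ∈ Finset.range (k + 1), g i}

theorem changes_eq_count (τ : ℝ) (g : ℕ → ℝ) (s : ℝ) : changes τ g s = count g (τ * s) := rfl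

/-- The event that the first `k` points lie in `(-∞, c]`. -/
def firstPointsLE (k : ℕ) (c : ℝ) : Set (ℕ → ℝ) :=
  {g | ∀ j < k, ∑ i ∈ Finset.range (j + 1), g i ≤ c}

/-- The event that the first point beyond `c` is the one with index `k`. -/
def countEvent (k : ℕ) (c : ℝ) : Set (ℕ → ℝ) :=
  firstPointsLE k c ∩ {g | c < ∑ i ∈ Finset.range (k + 1), g i}

/-- The gaps seen from `c` onwards, if the next point has index `k`. -/
def resid (k : ℕ) (c : ℝ) (g : ℕ → ℝ) (j : ℕ) : ℝ :=
  if j = 0 then ∑ i ∈ Finset.range (k + 1), g i - c else g (k + j)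

/-- The gaps seen from `c` onwards. -/
def restart (c : ℝ) (g : ℕ → ℝ) : ℕ → ℝ := resid (count g c) c g

/-- The gap sequences with unbounded partial sums. On them, `count` is not a junk value. -/
def goodGaps : Set (ℕ → ℝ) := {g | ∀ c : ℝ, ∃ k, c < ∑ i ∈ Finset.range (k + 1), g i}

theorem count_of_mem {k : ℕ} {c : ℝ} {g : ℕ → ℝ} (h : g ∈ countEvent k c) : count g c = k := by
  refine le_antisymm (Nat.sInf_le h.2) (le_csInf ⟨k, h.2⟩ fun j hj => ?_)
  by_contra! hjk
  exact absurd (h.1 j hjk) (not_le.2 hj)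

theorem mem_firstPointsLE_count (g : ℕ → ℝ) (c : ℝ) : g ∈ firstPointsLE (count g c) c :=
  fun _ hj => not_lt.1 fun h => absurd (Nat.sInf_le
    (s := {k | c < ∑ i ∈ Finset.range (k + 1), g i}) h) (not_le.2 hj)

theorem mem_countEvent {g : ℕ → ℝ} (hg : g ∈ goodGaps) (c : ℝ) : g ∈ countEvent (count g c) c :=
  ⟨mem_firstPointsLE_count g c, Nat.sInf_mem (hg c)⟩

theorem count_mono {g : ℕ → ℝ} (hg : g ∈ goodGaps) {c d : ℝ} (h : c ≤ d) :
    count g c ≤ count g d :=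
  csInf_le_csInf' (hg d) fun _ hk => h.trans_lt hk

theorem sum_consSeq (y : ℝ) (g : ℕ → ℝ) (k : ℕ) :
    ∑ i ∈ Finset.range (k + 1), consSeq y g i = y + ∑ i ∈ Finset.range k, g i := by
  rw [Finset.sum_range_succ', add_comm]; rfl

theorem sum_resid (k : ℕ) (c : ℝ) (g : ℕ → ℝ) (j : ℕ) :
    ∑ i ∈ Finset.range (j + 1), resid k c g i = ∑ i ∈ Finset.range (k + j + 1), g i - c := by
  induction j with
  | zero => simp [resid]
  | succ j ih =>
    rw [Finset.sum_range_succ, ih, ← add_assoc k j 1, Finset.sum_range_succ _ (k + j + 1)]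
    simp only [resid, Nat.succ_ne_zero, if_false]
    rw [← add_assoc k j 1]
    ring

/-- The points beyond `c + d` are counted by first restarting the process at `c`. -/
theorem count_add {g : ℕ → ℝ} (hg : g ∈ goodGaps) (c : ℝ) {d : ℝ} (hd : 0 ≤ d) :
    count g (c + d) = count g c + count (restart c g) d := by
  have h0 : {k | d < ∑ i ∈ Finset.range (k + 1), restart c g i} =
      {k | c + d < ∑ i ∈ Finset.range (count g c + k + 1), g i} := by
    ext k
    simp only [Set.mem_ofPred_eq, restart, sum_resid]
    constructor <;> intro h <;> linarith
  have hmem := mem_countEvent hg (c + d)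
  have hle : count g c ≤ count g (c + d) := count_mono hg (by linarith)
  obtain ⟨j, hj⟩ := Nat.exists_eq_add_of_le hle
  rw [hj]
  congr 1
  unfold count at hj ⊢
  rw [h0]
  have hj' : count g (c + d) = count g c + j := hj
  refine le_antisymm (le_csInf ⟨j, ?_⟩ fun i hi => ?_) (Nat.sInf_le ?_)
  · rw [Set.mem_ofPred_eq, ← hj']; exact hmem.2
  · have : count g (c + d) ≤ count g c + i := Nat.sInf_le hi
    omega
  · rw [Set.mem_ofPred_eq, ← hj']; exact hmem.2

theorem measurableSet_firstPointsLE (k : ℕ) (c : ℝ) : MeasurableSet (firstPointsLE k c) := by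
  have : firstPointsLE k c =
      ⋂ j, ⋂ (_ : j < k), {g : ℕ → ℝ | ∑ i ∈ Finset.range (j + 1), g i ≤ c} := by
    ext g; simp [firstPointsLE]
  rw [this]
  exact MeasurableSet.iInter fun j => MeasurableSet.iInter fun _ =>
    measurableSet_le (by fun_prop) measurable_const

theorem measurableSet_countEvent (k : ℕ) (c : ℝ) : MeasurableSet (countEvent k c) :=
  (measurableSet_firstPointsLE k c).inter (measurableSet_lt measurable_const (by fun_prop))

theorem measurable_count : Measurable fun p : (ℕ → ℝ) × ℝ => count p.1 p.2 := by
  have hP : ∀ k, MeasurableSet {p : (ℕ → ℝ) × ℝ | p.2 < ∑ i ∈ Finset.range (k + 1), p.1 i} :=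
    fun k => measurableSet_lt measurable_snd (by fun_prop)
  refine measurable_to_countable' fun k => ?_
  have : (fun p : (ℕ → ℝ) × ℝ => count p.1 p.2) ⁻¹' {k} =
      ({p | p.2 < ∑ i ∈ Finset.range (k + 1), p.1 i} ∩
        ⋂ j, ⋂ (_ : j < k), {p | p.2 < ∑ i ∈ Finset.range (j + 1), p.1 i}ᶜ) ∪
      ({_p | k = 0} ∩ ⋂ j, {p | p.2 < ∑ i ∈ Finset.range (j + 1), p.1 i}ᶜ) := by
    ext p
    simp only [Set.mem_preimage, Set.mem_singleton_iff, Set.mem_union, Set.mem_inter_iff,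
      Set.mem_iInter, Set.mem_compl_iff, Set.mem_ofPred_eq]
    constructor
    · intro h
      by_cases hne : ∃ j, p.2 < ∑ i ∈ Finset.range (j + 1), p.1 i
      · left
        rw [← h]
        exact ⟨Nat.sInf_mem hne, fun j hj => Nat.notMem_of_lt_sInf hj⟩
      · right
        push Not at hne
        refine ⟨?_, fun j => not_lt.2 (hne j)⟩
        rw [← h]
        refine Nat.sInf_eq_zero.2 (Or.inr ?_)
        exact Set.eq_empty_of_forall_notMem fun j hj => absurd hj (not_lt.2 (hne j))
    · rintro (⟨h1, h2⟩ | ⟨rfl, h2⟩)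
      · refine le_antisymm (Nat.sInf_le h1) (le_csInf ⟨k, h1⟩ fun j hj => ?_)
        by_contra! hjk
        exact h2 j hjk hj
      · refine Nat.sInf_eq_zero.2 (Or.inr ?_)
        exact Set.eq_empty_of_forall_notMem fun j hj => h2 j hj
  rw [this]
  refine ((hP k).inter (MeasurableSet.iInter fun j => MeasurableSet.iInter fun _ =>
    (hP j).compl)).union ((MeasurableSet.const _).inter (MeasurableSet.iInter fun j => (hP j).compl))

theorem measurable_resid (k : ℕ) (c : ℝ) : Measurable (resid k c) := by
  refine measurable_pi_iff.2 fun j => ?_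
  unfold resid
  split_ifs <;> fun_prop

theorem measurable_restart (c : ℝ) : Measurable (restart c) := by
  have h : Measurable fun p : (ℕ → ℝ) × ℕ => resid p.2 c p.1 :=
    measurable_from_prod_countable_left fun k => measurable_resid k c
  exact h.comp (measurable_id.prodMk
    (measurable_count.comp (measurable_id.prodMk measurable_const)))

theorem firstPointsLE_succ_consSeq (k : ℕ) (c y : ℝ) (g : ℕ → ℝ) :
    consSeq y g ∈ firstPointsLE (k + 1) c ↔ y ≤ c ∧ g ∈ firstPointsLE k (c - y) := by
  simp only [firstPointsLE, Set.mem_ofPred_eq, sum_consSeq]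
  constructor
  · intro h
    refine ⟨by simpa using h 0 (Nat.succ_pos k), fun j hj => ?_⟩
    have := h (j + 1) (by omega)
    linarith
  · rintro ⟨h0, h⟩ j hj
    cases j with
    | zero => simpa using h0
    | succ j =>
      have := h j (by omega)
      linarith

theorem iidLaw_gapLaw_apply {A : Set (ℕ → ℝ)} (hA : MeasurableSet A) :
    iidLaw gapLaw A = ∫⁻ y, iidLaw gapLaw {g | consSeq y g ∈ A} ∂gapLaw := by
  rw [← (measurePreserving_consSeq gapLaw).measure_preimage hA.nullMeasurableSet,
    Measure.prod_apply (measurable_consSeq hA)]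
  rfl

/-- An exponential bound for the probability of at least `k` points. -/
theorem iidLaw_firstPointsLE_le (k : ℕ) {c : ℝ} (hc : 0 ≤ c) :
    iidLaw gapLaw (firstPointsLE k c) ≤ ENNReal.ofReal (Real.exp c) * 2⁻¹ ^ k := by
  induction k generalizing c with
  | zero =>
    refine prob_le_one.trans ?_
    simpa using hc
  | succ k ih =>
    rw [iidLaw_gapLaw_apply (measurableSet_firstPointsLE _ _)]
    have : ∀ y, iidLaw gapLaw {g | consSeq y g ∈ firstPointsLE (k + 1) c} ≤
        ENNReal.ofReal (Real.exp c) * 2⁻¹ ^ k * ENNReal.ofReal (Real.exp (-y)) := by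
      intro y
      simp only [firstPointsLE_succ_consSeq]
      by_cases hy : y ≤ c
      · simp only [hy, true_and]
        refine (ih (sub_nonneg.2 hy)).trans (le_of_eq ?_)
        rw [sub_eq_add_neg, Real.exp_add, ENNReal.ofReal_mul (Real.exp_nonneg _)]
        ring
      · simp [hy]
    refine (lintegral_mono this).trans (le_of_eq ?_)
    rw [lintegral_const_mul _ (by fun_prop), lintegral_exp_neg_gapLaw, pow_succ, mul_assoc]

theorem ae_goodGaps : ∀ᵐ g ∂iidLaw gapLaw, g ∈ goodGaps := by
  have h : ∀ n : ℕ, ∀ᵐ g ∂iidLaw gapLaw, ∃ k, (n : ℝ) < ∑ i ∈ Finset.range (k + 1), g i := by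
    intro n
    rw [ae_iff]
    have hle : ∀ k : ℕ, iidLaw gapLaw {g | ¬∃ k, (n : ℝ) < ∑ i ∈ Finset.range (k + 1), g i} ≤
        ENNReal.ofReal (Real.exp n) * 2⁻¹ ^ k := by
      intro k
      refine le_trans (measure_mono ?_) (iidLaw_firstPointsLE_le k (Nat.cast_nonneg n))
      intro g hg j _
      simp only [Set.mem_ofPred_eq, not_exists, not_lt] at hg
      exact hg j
    have ht : Filter.Tendsto (fun k : ℕ => ENNReal.ofReal (Real.exp n) * (2⁻¹ : ℝ≥0∞) ^ k)
        Filter.atTop (𝓝 (ENNReal.ofReal (Real.exp n) * 0)) :=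
      ENNReal.Tendsto.const_mul (ENNReal.tendsto_pow_atTop_nhds_zero_of_lt_one (by
        rw [ENNReal.inv_lt_one]; exact ENNReal.one_lt_two)) (Or.inr ENNReal.ofReal_ne_top)
    rw [mul_zero] at ht
    exact le_antisymm (ge_of_tendsto' ht hle) bot_le
  filter_upwards [ae_all_iff.2 h] with g hg c
  obtain ⟨n, hn⟩ := exists_nat_gt c
  obtain ⟨k, hk⟩ := hg n
  exact ⟨k, hn.trans hk⟩

theorem resid_succ_consSeq (k : ℕ) (c y : ℝ) (g : ℕ → ℝ) :
    resid (k + 1) c (consSeq y g) = resid k (c - y) g := by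
  funext j
  unfold resid
  split_ifs
  · rw [sum_consSeq]; ring
  · rw [show k + 1 + j = (k + j) + 1 by ring]; rfl

theorem resid_zero_consSeq (c y : ℝ) (g : ℕ → ℝ) :
    resid 0 c (consSeq y g) = consSeq (y - c) g := by
  funext j
  unfold resid
  cases j with
  | zero => simp [consSeq]
  | succ j => simp [consSeq]

/-- Given that the next point beyond `c` has index `k`, the gaps seen from `c` onwards are again
independent and exponential. -/
theorem iidLaw_countEvent_inter_resid (k : ℕ) {c : ℝ} (hc : 0 ≤ c) {A : Set (ℕ → ℝ)}
    (hA : MeasurableSet A) :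
    iidLaw gapLaw (countEvent k c ∩ resid k c ⁻¹' A) =
      iidLaw gapLaw (countEvent k c) * iidLaw gapLaw A := by
  induction k generalizing c A with
  | zero =>
    have key : ∀ A : Set (ℕ → ℝ), MeasurableSet A →
        iidLaw gapLaw (countEvent 0 c ∩ resid 0 c ⁻¹' A) =
          ENNReal.ofReal (Real.exp (-c)) * iidLaw gapLaw A := by
      intro A hA
      have hm := (measurableSet_countEvent 0 c).inter (measurable_resid 0 c hA)
      have hF : Measurable fun y => iidLaw gapLaw {g | consSeq y g ∈ A} :=
        measurable_measure_prodMk_left (measurable_consSeq hA)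
      rw [iidLaw_gapLaw_apply hm, iidLaw_gapLaw_apply hA, ← smul_eq_mul,
        ← lintegral_smul_measure, ← map_sub_restrict_gapLaw hc,
        lintegral_map hF (by fun_prop), ← lintegral_indicator measurableSet_Ioi]
      refine lintegral_congr fun y => ?_
      by_cases hy : y ∈ Set.Ioi c
      · rw [Set.indicator_of_mem hy]
        congr 1
        ext g
        have hy' : c < y := hy
        simp [countEvent, firstPointsLE, resid_zero_consSeq, consSeq, hy']
      · rw [Set.indicator_of_notMem hy, ← measure_empty (μ := iidLaw gapLaw)]
        congr 1
        ext g
        have hy' : ¬ c < y := hy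
        simp [countEvent, consSeq, hy']
    have h1 := key Set.univ MeasurableSet.univ
    rw [Set.preimage_univ, Set.inter_univ, measure_univ, mul_one] at h1
    rw [key A hA, h1]
  | succ k ih =>
    have key : ∀ A : Set (ℕ → ℝ), MeasurableSet A →
        iidLaw gapLaw (countEvent (k + 1) c ∩ resid (k + 1) c ⁻¹' A) =
          (∫⁻ y, if y ≤ c then iidLaw gapLaw (countEvent k (c - y)) else 0 ∂gapLaw) *
            iidLaw gapLaw A := by
      intro A hA
      rw [iidLaw_gapLaw_apply ((measurableSet_countEvent _ c).inter (measurable_resid _ c hA)),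
        ← lintegral_mul_const' _ _ (measure_ne_top _ _)]
      refine lintegral_congr fun y => ?_
      split_ifs with hy
      · rw [← ih (sub_nonneg.2 hy) hA]
        congr 1
        ext g
        simp only [countEvent, Set.mem_inter_iff, Set.mem_ofPred_eq, firstPointsLE_succ_consSeq,
          Set.mem_preimage, resid_succ_consSeq, sum_consSeq, hy, true_and, sub_lt_iff_lt_add']
      · rw [zero_mul, ← measure_empty (μ := iidLaw gapLaw)]
        congr 1
        ext g
        simp [countEvent, firstPointsLE_succ_consSeq, hy]
    have h1 := key Set.univ MeasurableSet.univ
    rw [Set.preimage_univ, Set.inter_univ, measure_univ, mul_one] at h1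
    rw [key A hA, h1]

/-- The Poisson process has no memory. -/
theorem measurePreserving_restart {c : ℝ} (hc : 0 ≤ c) :
    MeasurePreserving (restart c) (iidLaw gapLaw) (iidLaw gapLaw) := by
  refine ⟨measurable_restart c, Measure.ext fun A hA => ?_⟩
  rw [Measure.map_apply (measurable_restart c) hA]
  have hdisj : ∀ B : ℕ → Set (ℕ → ℝ), Pairwise (Function.onFun Disjoint
      fun k => countEvent k c ∩ B k) := by
    intro B i j hij
    refine Set.disjoint_left.2 fun g hi hj => hij ?_
    rw [← count_of_mem hi.1, ← count_of_mem hj.1]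
  have h1 : restart c ⁻¹' A =ᵐ[iidLaw gapLaw] ⋃ k, countEvent k c ∩ resid k c ⁻¹' A := by
    filter_upwards [ae_goodGaps] with g hg
    apply propext
    change restart c g ∈ A ↔ g ∈ ⋃ k, countEvent k c ∩ resid k c ⁻¹' A
    simp only [Set.mem_iUnion, Set.mem_inter_iff, Set.mem_preimage]
    constructor
    · exact fun h => ⟨count g c, mem_countEvent hg c, h⟩
    · rintro ⟨k, hk, h⟩
      rwa [restart, count_of_mem hk]
  have h2 : (Set.univ : Set (ℕ → ℝ)) =ᵐ[iidLaw gapLaw] ⋃ k, countEvent k c ∩ Set.univ := by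
    filter_upwards [ae_goodGaps] with g hg
    apply propext
    change g ∈ Set.univ ↔ g ∈ ⋃ k, countEvent k c ∩ Set.univ
    simp only [Set.inter_univ, Set.mem_univ, true_iff]
    exact Set.mem_iUnion.2 ⟨_, mem_countEvent hg c⟩
  have h3 : ∑' k, iidLaw gapLaw (countEvent k c) = 1 := by
    rw [← measure_univ (μ := iidLaw gapLaw), measure_congr h2, measure_iUnion (hdisj _)
      (fun k => (measurableSet_countEvent k c).inter MeasurableSet.univ)]
    simp only [Set.inter_univ]
  rw [measure_congr h1, measure_iUnion (hdisj _)
    (fun k => (measurableSet_countEvent k c).inter (measurable_resid k c hA))]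
  simp only [iidLaw_countEvent_inter_resid _ hc hA]
  rw [ENNReal.tsum_mul_right, h3, one_mul]

/-- The present and later headings and the gaps of a node, seen from the time `c` of its unit-rate
Poisson clock. -/
def renew (c : ℝ) (y : (ℕ → ℝ) × (ℕ → ℝ)) : (ℕ → ℝ) × (ℕ → ℝ) :=
  (fun n => y.1 (count y.2 c + n), restart c y.2)

theorem measurable_shift_count (c : ℝ) :
    Measurable fun y : (ℕ → ℝ) × (ℕ → ℝ) => fun n => y.1 (count y.2 c + n) := by
  have h : Measurable fun p : (ℕ → ℝ) × ℕ => fun n => p.1 (p.2 + n) :=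
    measurable_from_prod_countable_left fun k => by
      refine measurable_pi_iff.2 fun n => ?_
      exact measurable_pi_apply (k + n)
  exact h.comp (measurable_fst.prodMk
    (measurable_count.comp (measurable_snd.prodMk measurable_const)))

/-- Given the gaps, the headings are shifted by a fixed number of terms, so they stay independent
of the restarted clock. -/
theorem measurePreserving_renew (μ : Measure ℝ) [IsProbabilityMeasure μ] {c : ℝ} (hc : 0 ≤ c) :
    MeasurePreserving (renew c) ((iidLaw μ).prod (iidLaw gapLaw))
      ((iidLaw μ).prod (iidLaw gapLaw)) := by
  have h := (measurePreserving_restart hc).skew_product (μc := iidLaw μ) (μd := iidLaw μ)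
    (g := fun g θ n => θ (count g c + n))
    ((measurable_shift_count c).comp measurable_swap)
    (Filter.Eventually.of_forall fun g => (measurePreserving_shiftSeq μ _).map_eq)
  exact (Measure.measurePreserving_swap.comp h).comp Measure.measurePreserving_swap

/-! ### Reflected headings -/

/-- The angle in `[0, 2π)` of a plane vector with coordinates `a` and `b`. -/
def angle (a b : ℝ) : ℝ := toIcoMod Real.two_pi_pos 0 (Complex.arg (a + b * Complex.I))

theorem cos_angle {a b : ℝ} (h : a * a + b * b = 1) : Real.cos (angle a b) = a := by
  have hn : ‖(a + b * Complex.I : ℂ)‖ = 1 := by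
    rw [Complex.norm_add_mul_I, show a ^ 2 + b ^ 2 = 1 by linarith, Real.sqrt_one]
  have h0 : (a + b * Complex.I : ℂ) ≠ 0 := by
    intro h; rw [h, norm_zero] at hn; exact zero_ne_one hn
  rw [angle, toIcoMod, zsmul_eq_mul, Real.cos_sub_int_mul_two_pi, Complex.cos_arg h0, hn]
  simp

theorem sin_angle {a b : ℝ} (h : a * a + b * b = 1) : Real.sin (angle a b) = b := by
  have hn : ‖(a + b * Complex.I : ℂ)‖ = 1 := by
    rw [Complex.norm_add_mul_I, show a ^ 2 + b ^ 2 = 1 by linarith, Real.sqrt_one]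
  rw [angle, toIcoMod, zsmul_eq_mul, Real.sin_sub_int_mul_two_pi, Complex.sin_arg, hn]
  simp

theorem angle_cos_sin (φ : ℝ) :
    angle (Real.cos φ) (Real.sin φ) = toIcoMod Real.two_pi_pos 0 φ := by
  rw [angle, Complex.ofReal_cos, Complex.ofReal_sin, Complex.arg_cos_add_sin_mul_I_eq_toIocMod,
    toIocMod, toIcoMod_sub_zsmul]

/-- The direction angle in `[0, 2π)` obtained from `θ` by multiplying the two coordinates of the
heading by the signs `σ`. -/
def reflect (σ : ℝ × ℝ) (θ : ℝ) : ℝ := angle (σ.1 * Real.cos θ) (σ.2 * Real.sin θ)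

/-- The pairs of signs. -/
def IsSigns (σ : ℝ × ℝ) : Prop := (σ.1 = 1 ∨ σ.1 = -1) ∧ (σ.2 = 1 ∨ σ.2 = -1)

theorem IsSigns.sq_fst {σ : ℝ × ℝ} (h : IsSigns σ) : σ.1 * σ.1 = 1 := by
  rcases h.1 with h | h <;> simp [h]

theorem IsSigns.sq_snd {σ : ℝ × ℝ} (h : IsSigns σ) : σ.2 * σ.2 = 1 := by
  rcases h.2 with h | h <;> simp [h]

theorem IsSigns.reflect_aux {σ : ℝ × ℝ} (h : IsSigns σ) (θ : ℝ) :
    (σ.1 * Real.cos θ) * (σ.1 * Real.cos θ) + (σ.2 * Real.sin θ) * (σ.2 * Real.sin θ) = 1 := by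
  have h1 := h.sq_fst
  have h2 := h.sq_snd
  have h3 := Real.cos_sq_add_sin_sq θ
  linear_combination (Real.cos θ) ^ 2 * h1 + (Real.sin θ) ^ 2 * h2 + h3

theorem cos_reflect {σ : ℝ × ℝ} (h : IsSigns σ) (θ : ℝ) :
    Real.cos (reflect σ θ) = σ.1 * Real.cos θ := cos_angle (h.reflect_aux θ)

theorem sin_reflect {σ : ℝ × ℝ} (h : IsSigns σ) (θ : ℝ) :
    Real.sin (reflect σ θ) = σ.2 * Real.sin θ := sin_angle (h.reflect_aux θ)

theorem reflect_reflect (ρ : ℝ × ℝ) {σ : ℝ × ℝ} (h : IsSigns σ) (θ : ℝ) :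
    reflect ρ (reflect σ θ) = reflect (ρ * σ) θ := by
  rw [reflect, cos_reflect h, sin_reflect h, reflect, Prod.fst_mul, Prod.snd_mul, mul_assoc,
    mul_assoc]

theorem measurable_toIcoMod : Measurable (toIcoMod Real.two_pi_pos (0 : ℝ)) := by
  have : toIcoMod Real.two_pi_pos (0 : ℝ) =
      fun x => 0 + Int.fract ((x - 0) / (2 * Real.pi)) * (2 * Real.pi) :=
    funext fun x => toIcoMod_eq_add_fract_mul _ _ _
  rw [this]
  have h : Measurable fun x : ℝ => Int.fract ((x - 0) / (2 * Real.pi)) :=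
    measurable_fract.comp (by fun_prop)
  fun_prop

theorem measurable_reflect : Measurable fun p : (ℝ × ℝ) × ℝ => reflect p.1 p.2 := by
  unfold reflect angle
  exact measurable_toIcoMod.comp (Complex.measurable_arg.comp (by fun_prop))

theorem lintegral_directionLaw (f : ℝ → ℝ≥0∞) :
    ∫⁻ θ, f θ ∂directionLaw =
      (ENNReal.ofReal (2 * Real.pi))⁻¹ * ∫⁻ θ in Set.Ioc 0 (2 * Real.pi), f θ := by
  rw [directionLaw, ProbabilityTheory.cond, lintegral_smul_measure, Real.volume_Ico, sub_zero,
    smul_eq_mul, setLIntegral_congr Ico_ae_eq_Ioc]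

theorem lintegral_toIcoMod {f : ℝ → ℝ≥0∞} {a : ℝ} (ha : a = 1 ∨ a = -1) (b : ℝ) :
    ∫⁻ θ, f (toIcoMod Real.two_pi_pos 0 (a * θ + b)) ∂directionLaw = ∫⁻ θ, f θ ∂directionLaw := by
  rw [lintegral_directionLaw, lintegral_directionLaw]
  congr 1
  set F : ℝ → ℝ≥0∞ := fun x => f (toIcoMod Real.two_pi_pos 0 x) with hF
  have hper : Function.Periodic F (2 * Real.pi) := fun x => by
    simp only [hF, toIcoMod_add_right]
  have h1 : ∫⁻ x in Set.Ioc 0 (2 * Real.pi), f x = ∫⁻ x in Set.Ioc 0 (0 + 2 * Real.pi), F x := by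
    rw [zero_add, setLIntegral_congr Ico_ae_eq_Ioc.symm, setLIntegral_congr Ico_ae_eq_Ioc.symm]
    refine setLIntegral_congr_fun measurableSet_Ico fun x hx => ?_
    simp only [hF]
    rw [(toIcoMod_eq_self Real.two_pi_pos).2 (by simpa using hx)]
  rw [h1]
  rcases ha with rfl | rfl
  · simp only [one_mul]
    have := lintegral_Ioc_periodic_add Real.two_pi_pos hper 0 0 b
    rwa [zero_add] at this ⊢
  · simp only [neg_one_mul]
    rw [← lintegral_Ioc_periodic_add Real.two_pi_pos hper (-(2 * Real.pi)) 0 b,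
      lintegral_Ioc_neg (fun x => F (x + b))]
    simp

/-- On angles, a reflection is `θ ↦ ± θ + b` modulo `2π`. -/
theorem measurePreserving_reflect {σ : ℝ × ℝ} (h : IsSigns σ) :
    MeasurePreserving (reflect σ) directionLaw directionLaw := by
  have hm : Measurable (reflect σ) := measurable_reflect.comp measurable_prodMk_left
  refine ⟨hm, Measure.ext_of_lintegral _ fun f hf => ?_⟩
  rw [lintegral_map hf hm]
  obtain ⟨a, b, ha, hab⟩ : ∃ a b : ℝ, (a = 1 ∨ a = -1) ∧
      ∀ θ, σ.1 * Real.cos θ = Real.cos (a * θ + b) ∧ σ.2 * Real.sin θ = Real.sin (a * θ + b) := by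
    rcases h.1 with h1 | h1 <;> rcases h.2 with h2 | h2
    · exact ⟨1, 0, by simp, fun θ => by simp [h1, h2]⟩
    · exact ⟨-1, 0, by simp, fun θ => by simp [h1, h2]⟩
    · exact ⟨-1, Real.pi, by simp, fun θ => by simp [h1, h2, Real.cos_add_pi, Real.sin_add_pi]⟩
    · exact ⟨1, Real.pi, by simp, fun θ => by simp [h1, h2, Real.cos_add_pi, Real.sin_add_pi]⟩
  have : ∀ θ, reflect σ θ = toIcoMod Real.two_pi_pos 0 (a * θ + b) := fun θ => by
    rw [reflect, (hab θ).1, (hab θ).2, angle_cos_sin]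
  simp only [this]
  exact lintegral_toIcoMod ha b

/-- All headings of a node reflected by the signs `σ`. -/
def reflectSeq (σ : ℝ × ℝ) (y : (ℕ → ℝ) × (ℕ → ℝ)) : (ℕ → ℝ) × (ℕ → ℝ) :=
  (fun n => reflect σ (y.1 n), y.2)

theorem measurable_reflectSeq :
    Measurable fun p : (ℝ × ℝ) × ((ℕ → ℝ) × (ℕ → ℝ)) => reflectSeq p.1 p.2 := by
  refine Measurable.prodMk (measurable_pi_iff.2 fun n => ?_) (by fun_prop)
  exact measurable_reflect.comp (measurable_fst.prodMk
    ((measurable_pi_apply n).comp (measurable_fst.comp measurable_snd)))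

theorem measurePreserving_reflectSeq {σ : ℝ × ℝ} (h : IsSigns σ) :
    MeasurePreserving (reflectSeq σ) ((iidLaw directionLaw).prod (iidLaw gapLaw))
      ((iidLaw directionLaw).prod (iidLaw gapLaw)) := by
  have h1 := measurePreserving_reflect h
  have h2 : MeasurePreserving (fun (θ : ℕ → ℝ) n => reflect σ (θ n)) (iidLaw directionLaw)
      (iidLaw directionLaw) := by
    refine ⟨measurable_pi_iff.2 fun n => h1.measurable.comp (measurable_pi_apply n), ?_⟩
    rw [iidLaw, Measure.infinitePi_map_pi _ (fun _ => h1.measurable)]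
    congr! 1
    funext _
    exact h1.map_eq
  exact h2.prod (MeasurePreserving.id _)

/-! ### Displacements -/

/-- One coordinate of the displacement of the free path up to time `s`, where `F` is the cosine or
the sine. -/
def displ (F : ℝ → ℝ) (v τ : ℝ) (y : (ℕ → ℝ) × (ℕ → ℝ)) (s : ℝ) : ℝ :=
  ∫ u in (0 : ℝ)..s, v * F (y.1 (count y.2 (τ * u)))

theorem measurable_current (τ : ℝ) :
    Measurable fun p : ((ℕ → ℝ) × (ℕ → ℝ)) × ℝ => p.1.1 (count p.1.2 (τ * p.2)) := by
  have h : Measurable fun p : (ℕ → ℝ) × ℕ => p.1 p.2 :=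
    measurable_from_prod_countable_left fun k => measurable_pi_apply k
  refine h.comp ((measurable_fst.comp measurable_fst).prodMk
    (measurable_count.comp (f := fun p : ((ℕ → ℝ) × (ℕ → ℝ)) × ℝ => (p.1.2, τ * p.2)) ?_))
  fun_prop

theorem measurable_displ {F : ℝ → ℝ} (hF : Measurable F) (v τ s : ℝ) :
    Measurable fun y => displ F v τ y s := by
  have h : StronglyMeasurable fun p : ((ℕ → ℝ) × (ℕ → ℝ)) × ℝ =>
      v * F (p.1.1 (count p.1.2 (τ * p.2))) :=
    ((hF.comp (measurable_current τ)).const_mul v).stronglyMeasurable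
  unfold displ intervalIntegral
  exact (h.integral_prod_right'.sub h.integral_prod_right').measurable

theorem intervalIntegrable_of_bounded {f : ℝ → ℝ} (hf : Measurable f) {C : ℝ}
    (hC : ∀ u, |f u| ≤ C) (a b : ℝ) : IntervalIntegrable f volume a b := by
  refine (intervalIntegrable_const (c := C)).mono_fun hf.aestronglyMeasurable ?_
  exact Filter.Eventually.of_forall fun u => (hC u).trans (le_abs_self C)

theorem measurable_speed {F : ℝ → ℝ} (hF : Measurable F) (v τ : ℝ)
    (y : (ℕ → ℝ) × (ℕ → ℝ)) : Measurable fun u => v * F (y.1 (count y.2 (τ * u))) :=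
  (hF.comp ((measurable_current τ).comp measurable_prodMk_left)).const_mul v

theorem abs_speed_le {F : ℝ → ℝ} (hF : ∀ x, |F x| ≤ 1) (v x : ℝ) : |v * F x| ≤ |v| := by
  rw [abs_mul]
  exact mul_le_of_le_one_right (abs_nonneg v) (hF x)

/-- The displacement up to time `s + u` is the displacement up to time `s` followed by a
displacement of the renewed process. -/
theorem displ_add {F : ℝ → ℝ} (hFm : Measurable F) (hF : ∀ x, |F x| ≤ 1) (v : ℝ) {τ : ℝ}
    (hτ : 0 ≤ τ) {y : (ℕ → ℝ) × (ℕ → ℝ)} (hy : y.2 ∈ goodGaps) (s : ℝ) {u : ℝ} (hu : 0 ≤ u) :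
    displ F v τ y (s + u) = displ F v τ y s + displ F v τ (renew (τ * s) y) u := by
  have hint := intervalIntegrable_of_bounded (measurable_speed hFm v τ y)
    (fun u => abs_speed_le hF v _)
  rw [displ, ← intervalIntegral.integral_add_adjacent_intervals (hint 0 s) (hint s (s + u))]
  congr 1
  have h1 := intervalIntegral.integral_comp_add_left
    (fun u => v * F (y.1 (count y.2 (τ * u)))) (a := 0) (b := u) s
  rw [add_zero] at h1
  rw [← h1, displ]
  refine intervalIntegral.integral_congr fun x hx => ?_
  rw [Set.uIcc_of_le hu] at hx
  simp only [mul_add, count_add hy (τ * s) (mul_nonneg hτ hx.1)]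
  rfl

theorem displ_reflect_cos {σ : ℝ × ℝ} (h : IsSigns σ) (v τ : ℝ) (y : (ℕ → ℝ) × (ℕ → ℝ)) (s : ℝ) :
    displ Real.cos v τ (reflectSeq σ y) s = σ.1 * displ Real.cos v τ y s := by
  unfold displ
  rw [← intervalIntegral.integral_const_mul]
  refine intervalIntegral.integral_congr fun x _ => ?_
  simp only [reflectSeq, cos_reflect h]
  ring

theorem displ_reflect_sin {σ : ℝ × ℝ} (h : IsSigns σ) (v τ : ℝ) (y : (ℕ → ℝ) × (ℕ → ℝ)) (s : ℝ) :
    displ Real.sin v τ (reflectSeq σ y) s = σ.2 * displ Real.sin v τ y s := by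
  unfold displ
  rw [← intervalIntegral.integral_const_mul]
  refine intervalIntegral.integral_congr fun x _ => ?_
  simp only [reflectSeq, sin_reflect h]
  ring

/-- While the number of direction changes does not vary, the motion is uniform. -/
theorem displ_sub_of_count_eq {F : ℝ → ℝ} (hFm : Measurable F) (hF : ∀ x, |F x| ≤ 1) (v τ : ℝ)
    (y : (ℕ → ℝ) × (ℕ → ℝ)) {a b : ℝ} {k : ℕ} (hab : a ≤ b)
    (hk : ∀ u ∈ Set.Icc a b, count y.2 (τ * u) = k) :
    displ F v τ y b - displ F v τ y a = (b - a) * (v * F (y.1 k)) := by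
  have hint := intervalIntegrable_of_bounded (measurable_speed hFm v τ y)
    (fun u => abs_speed_le hF v _)
  rw [displ, displ, intervalIntegral.integral_interval_sub_left (hint _ _) (hint _ _),
    intervalIntegral.integral_congr (g := fun _ => v * F (y.1 k)), intervalIntegral.integral_const,
    smul_eq_mul]
  intro u hu
  rw [Set.uIcc_of_le hab] at hu
  simp only [hk u hu]

theorem abs_displ_le {F : ℝ → ℝ} (hF : ∀ x, |F x| ≤ 1) (v τ : ℝ)
    (y : (ℕ → ℝ) × (ℕ → ℝ)) (s : ℝ) : |displ F v τ y s| ≤ |v| * |s| := by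
  have := intervalIntegral.norm_integral_le_of_norm_le_const (a := 0) (b := s) (C := |v|)
    (f := fun u => v * F (y.1 (count y.2 (τ * u)))) (fun u _ => abs_speed_le hF v _)
  rwa [sub_zero] at this

theorem freePath_eq (v τ : ℝ) (ω : NodeSample) (s : ℝ) :
    freePath v τ ω s = ω.1 + !₂[displ Real.cos v τ ω.2 s, displ Real.sin v τ ω.2 s] := by
  unfold freePath
  congr 1
  have hm : Measurable fun u => v • heading (ω.2.1 (changes τ ω.2.2 u)) := by
    have h1 : Measurable heading := by
      unfold heading
      refine (PiLp.continuous_toLp 2 _).measurable.comp (measurable_pi_iff.2 fun i => ?_)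
      fin_cases i
      · exact Real.measurable_cos
      · exact Real.measurable_sin
    exact (h1.comp ((measurable_current τ).comp measurable_prodMk_left)).const_smul v
  have hint : IntervalIntegrable (fun u => v • heading (ω.2.1 (changes τ ω.2.2 u))) volume 0 s := by
    refine (intervalIntegrable_const (c := |v|)).mono_fun hm.aestronglyMeasurable ?_
    refine Filter.Eventually.of_forall fun u => ?_
    simp [norm_smul, heading, EuclideanSpace.norm_eq]
  ext i
  have := (EuclideanSpace.proj (𝕜 := ℝ) i : Plane →L[ℝ] ℝ).intervalIntegral_comp_comm hint
  refine Eq.trans this.symm ?_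
  fin_cases i <;> simp [displ, heading, changes_eq_count]

theorem freePath_zero (v τ : ℝ) (ω : NodeSample) (s : ℝ) :
    freePath v τ ω s 0 = ω.1 0 + displ Real.cos v τ ω.2 s := by
  rw [freePath_eq]; simp

theorem freePath_one (v τ : ℝ) (ω : NodeSample) (s : ℝ) :
    freePath v τ ω s 1 = ω.1 1 + displ Real.sin v τ ω.2 s := by
  rw [freePath_eq]; simp

theorem path_eq (L v τ : ℝ) (ω : NodeSample) (s : ℝ) :
    path L v τ ω s = !₂[fold L (ω.1 0 + displ Real.cos v τ ω.2 s),
      fold L (ω.1 1 + displ Real.sin v τ ω.2 s)] := by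
  rw [← freePath_zero, ← freePath_one]
  unfold path
  ext i
  fin_cases i <;> simp

/-! ### Stationarity -/

/-- The sample of a node seen from time `s` onwards: its position at time `s`, its later headings
as they appear after the reflections up to time `s`, and the gaps seen from time `s` onwards. -/
def shiftNode (L v τ s : ℝ) (ω : NodeSample) : NodeSample :=
  (path L v τ ω s, reflectSeq (foldSign L (ω.1 0 + displ Real.cos v τ ω.2 s),
    foldSign L (ω.1 1 + displ Real.sin v τ ω.2 s)) (renew (τ * s) ω.2))

theorem isSigns_foldSign (L a b : ℝ) : IsSigns (foldSign L a, foldSign L b) :=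
  ⟨foldSign_eq_or L a, foldSign_eq_or L b⟩

/-- The shifted sample generates the later part of the trajectory. -/
theorem path_shiftNode {L : ℝ} (hL : 0 < L) (v : ℝ) {τ : ℝ} (hτ : 0 ≤ τ) {ω : NodeSample}
    (hω : ω.2.2 ∈ goodGaps) (s : ℝ) {u : ℝ} (hu : 0 ≤ u) :
    path L v τ (shiftNode L v τ s ω) u = path L v τ ω (s + u) := by
  rw [path_eq, path_eq, displ_add Real.measurable_cos Real.abs_cos_le_one v hτ hω s hu,
    displ_add Real.measurable_sin Real.abs_sin_le_one v hτ hω s hu, ← add_assoc, ← add_assoc,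
    fold_add hL _ (displ Real.cos v τ (renew (τ * s) ω.2) u),
    fold_add hL _ (displ Real.sin v τ (renew (τ * s) ω.2) u)]
  unfold shiftNode
  simp only [displ_reflect_cos (isSigns_foldSign L _ _), displ_reflect_sin (isSigns_foldSign L _ _),
    path_eq]
  simp

theorem measurable_path (L v τ s : ℝ) : Measurable fun ω => path L v τ ω s := by
  simp only [path_eq]
  have h1 : Measurable fun ω : NodeSample => displ Real.cos v τ ω.2 s :=
    (measurable_displ Real.measurable_cos v τ s).comp measurable_snd
  have h2 : Measurable fun ω : NodeSample => displ Real.sin v τ ω.2 s :=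
    (measurable_displ Real.measurable_sin v τ s).comp measurable_snd
  refine (PiLp.continuous_toLp 2 _).measurable.comp (measurable_pi_iff.2 fun i => ?_)
  fin_cases i
  · exact (measurable_fold L).comp (Measurable.add (by fun_prop) h1)
  · exact (measurable_fold L).comp (Measurable.add (by fun_prop) h2)

theorem measurable_renew (c : ℝ) : Measurable (renew c) :=
  (measurable_shift_count c).prodMk ((measurable_restart c).comp measurable_snd)

theorem measurable_shiftNode (L v τ s : ℝ) : Measurable (shiftNode L v τ s) := by
  have h1 : Measurable fun ω : NodeSample => displ Real.cos v τ ω.2 s :=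
    (measurable_displ Real.measurable_cos v τ s).comp measurable_snd
  have h2 : Measurable fun ω : NodeSample => displ Real.sin v τ ω.2 s :=
    (measurable_displ Real.measurable_sin v τ s).comp measurable_snd
  refine (measurable_path L v τ s).prodMk (measurable_reflectSeq.comp (Measurable.prodMk
    (Measurable.prodMk ?_ ?_) ((measurable_renew _).comp measurable_snd)))
  · exact (measurable_foldSign L).comp (Measurable.add (by fun_prop) h1)
  · exact (measurable_foldSign L).comp (Measurable.add (by fun_prop) h2)

/-- The law of the headings and gaps of a node. -/
abbrev driveLaw : Measure ((ℕ → ℝ) × (ℕ → ℝ)) := (iidLaw directionLaw).prod (iidLaw gapLaw)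

/-- The phase space measure of a point in the square: for each coordinate, position and sign. -/
abbrev planePhase (L : ℝ) : Measure ((ℝ × ℝ) × (ℝ × ℝ)) := (phaseMeasure L).prod (phaseMeasure L)

/-- The sample of a node with the given position, whose headings are reflected by the given
signs. -/
def unphase (q : ((ℕ → ℝ) × (ℕ → ℝ)) × ((ℝ × ℝ) × (ℝ × ℝ))) : NodeSample :=
  (!₂[q.2.1.1, q.2.2.1], reflectSeq (q.2.1.2, q.2.2.2) q.1)

theorem ae_isSigns (L : ℝ) : ∀ᵐ p ∂planePhase L, IsSigns (p.1.2, p.2.2) := by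
  have h0 : ∀ᵐ c ∂signMeasure, c = 1 ∨ c = -1 := by
    rw [signMeasure, ae_add_measure_iff]
    constructor
    · rw [ae_dirac_eq]; exact Filter.eventually_pure.2 (Or.inl rfl)
    · rw [ae_dirac_eq]; exact Filter.eventually_pure.2 (Or.inr rfl)
  have h1 : ∀ᵐ p ∂phaseMeasure L, p.2 = 1 ∨ p.2 = -1 :=
    Measure.quasiMeasurePreserving_snd.ae h0
  filter_upwards [Measure.quasiMeasurePreserving_fst.ae h1,
    Measure.quasiMeasurePreserving_snd.ae h1] with p hp1 hp2
  exact ⟨hp1, hp2⟩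

/-- The measurable identification of `ℝ × ℝ` with the Euclidean plane. -/
def planeEquiv : ℝ × ℝ ≃ᵐ Plane :=
  MeasurableEquiv.finTwoArrow.symm.trans (MeasurableEquiv.toLp 2 (Fin 2 → ℝ))

theorem planeEquiv_apply (p : ℝ × ℝ) : planeEquiv p = !₂[p.1, p.2] := rfl

theorem measurePreserving_planeEquiv : MeasurePreserving planeEquiv volume volume :=
  (PiLp.volume_preserving_toLp (Fin 2)).comp (volume_preserving_finTwoArrow ℝ).symm

theorem planeEquiv_preimage_square (L : ℝ) :
    planeEquiv ⁻¹' square L = Set.Icc 0 L ×ˢ Set.Icc 0 L := by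
  ext p
  simp only [Set.mem_preimage, planeEquiv_apply, square, Set.mem_ofPred_eq, Fin.forall_fin_two,
    Set.mem_prod]
  rfl

theorem measurableSet_coordinates {I : Set ℝ} (hI : MeasurableSet I) :
    MeasurableSet {x : Plane | ∀ i, x i ∈ I} := by
  have : {x : Plane | ∀ i, x i ∈ I} = ⋂ i, {x | x i ∈ I} := by ext; simp
  rw [this]
  exact MeasurableSet.iInter fun i => hI.preimage (by fun_prop)

theorem measurableSet_square (L : ℝ) : MeasurableSet (square L) :=
  measurableSet_coordinates measurableSet_Icc

theorem volume_square (L : ℝ) : volume (square L) = ENNReal.ofReal L * ENNReal.ofReal L := by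
  rw [← measurePreserving_planeEquiv.measure_preimage (measurableSet_square L).nullMeasurableSet,
    planeEquiv_preimage_square, Measure.volume_eq_prod, Measure.prod_prod]
  simp

theorem volume_square_ne_zero {L : ℝ} (hL : 0 < L) : volume (square L) ≠ 0 := by
  rw [volume_square]; simp [hL]

theorem volume_square_ne_top (L : ℝ) : volume (square L) ≠ ⊤ := by
  rw [volume_square]; exact ENNReal.mul_ne_top ENNReal.ofReal_ne_top ENNReal.ofReal_ne_top

theorem measurePreserving_position (L : ℝ) :
    MeasurePreserving (fun p : (ℝ × ℝ) × (ℝ × ℝ) => (!₂[p.1.1, p.2.1] : Plane)) (planePhase L)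
      ((4 : ℝ≥0∞) • volume.restrict (square L)) := by
  have h1 : (phaseMeasure L).map Prod.fst = (2 : ℝ≥0∞) • volume.restrict (Set.Icc 0 L) := by
    rw [phaseMeasure, Measure.map_fst_prod]
    congr 1
    simp [signMeasure]
    norm_num
  have h2 : (planePhase L).map (Prod.map Prod.fst Prod.fst) =
      (4 : ℝ≥0∞) • volume.restrict (planeEquiv ⁻¹' square L) := by
    rw [← Measure.map_prod_map _ _ measurable_fst measurable_fst, h1, Measure.prod_smul_left,
      Measure.prod_smul_right, smul_smul, Measure.prod_restrict, planeEquiv_preimage_square]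
    congr 1
    norm_num
  have h3 := (measurePreserving_planeEquiv.restrict_preimage (measurableSet_square L)).smul_measure
    (4 : ℝ≥0∞)
  exact h3.comp ⟨measurable_fst.prodMap measurable_fst, h2⟩

/-- The law of a node, up to normalization, as an image of the phase space measure: the signs leave
no trace, because the law of the headings is invariant under reflections. -/
theorem measurePreserving_unphase {L : ℝ} (hL : 0 < L) :
    MeasurePreserving unphase (driveLaw.prod (planePhase L))
      ((4 * volume (square L)) • nodeLaw L) := by
  have h1 := (MeasurePreserving.id (planePhase L)).skew_product (μc := driveLaw) (μd := driveLaw)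
    (g := fun p y => reflectSeq (p.1.2, p.2.2) y)
    (measurable_reflectSeq.comp (f := fun q : ((ℝ × ℝ) × (ℝ × ℝ)) × ((ℕ → ℝ) × (ℕ → ℝ)) =>
      ((q.1.1.2, q.1.2.2), q.2)) (by fun_prop)) (by
      filter_upwards [ae_isSigns L] with p hp
      exact (measurePreserving_reflectSeq hp).map_eq)
  have h2 := (measurePreserving_position L).prod (MeasurePreserving.id driveLaw)
  have h3 := (h2.comp h1).comp (Measure.measurePreserving_swap (μ := driveLaw) (ν := planePhase L))
  have h4 : ((4 : ℝ≥0∞) • volume.restrict (square L)).prod driveLaw =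
      (4 * volume (square L)) • nodeLaw L := by
    rw [nodeLaw, ProbabilityTheory.cond, Measure.prod_smul_left, Measure.prod_smul_left, smul_smul,
      mul_assoc, ENNReal.mul_inv_cancel (volume_square_ne_zero hL) (volume_square_ne_top L), mul_one]
  rw [← h4]
  exact h3

/-- The law of a node is invariant under the passage of time. In phase space, time acts as a skew
product: the drive is renewed, and given the drive the position moves by a billiard map. -/
theorem measurePreserving_shiftNode {L : ℝ} (hL : 0 < L) (v : ℝ) {τ s : ℝ} (hτ : 0 ≤ τ)
    (hs : 0 ≤ s) : MeasurePreserving (shiftNode L v τ s) (nodeLaw L) (nodeLaw L) := by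
  have hskew := (measurePreserving_renew directionLaw (mul_nonneg hτ hs)).skew_product
    (μc := planePhase L) (μd := planePhase L)
    (g := fun y p => (billiard L (displ Real.cos v τ y s) p.1,
      billiard L (displ Real.sin v τ y s) p.2))
    (by
      have h1 : Measurable fun q : ((ℕ → ℝ) × (ℕ → ℝ)) × ((ℝ × ℝ) × (ℝ × ℝ)) =>
          displ Real.cos v τ q.1 s := (measurable_displ Real.measurable_cos v τ s).comp measurable_fst
      have h2 : Measurable fun q : ((ℕ → ℝ) × (ℕ → ℝ)) × ((ℝ × ℝ) × (ℝ × ℝ)) =>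
          displ Real.sin v τ q.1 s := (measurable_displ Real.measurable_sin v τ s).comp measurable_fst
      have hb : Measurable fun q : ℝ × (ℝ × ℝ) => billiard L q.1 q.2 := by
        unfold billiard; fun_prop
      exact (hb.comp (h1.prodMk (measurable_fst.comp measurable_snd))).prodMk
        (hb.comp (h2.prodMk (measurable_snd.comp measurable_snd))))
    (Filter.Eventually.of_forall fun y =>
      ((measurePreserving_billiard hL _).prod (measurePreserving_billiard hL _)).map_eq)
  have hU := measurePreserving_unphase hL
  have hm := measurable_shiftNode L v τ s
  have hcongr : shiftNode L v τ s ∘ unphase =ᵐ[driveLaw.prod (planePhase L)]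
      unphase ∘ fun q => (renew (τ * s) q.1, (billiard L (displ Real.cos v τ q.1 s) q.2.1,
        billiard L (displ Real.sin v τ q.1 s) q.2.2)) := by
    filter_upwards [Measure.quasiMeasurePreserving_snd.ae (ae_isSigns L)] with q hq
    refine Prod.ext ?_ ?_
    · simp [shiftNode, unphase, path_eq, billiard, displ_reflect_cos hq, displ_reflect_sin hq]
    · refine Prod.ext ?_ ?_
      · funext n
        simp only [shiftNode, unphase, Function.comp, reflectSeq, renew, billiard,
          reflect_reflect _ hq]
        change reflect (foldSign L (_ + displ Real.cos v τ (reflectSeq (q.2.1.2, q.2.2.2) q.1) s) *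
          q.2.1.2, foldSign L (_ + displ Real.sin v τ (reflectSeq (q.2.1.2, q.2.2.2) q.1) s) *
          q.2.2.2) _ = _
        simp [displ_reflect_cos hq, displ_reflect_sin hq]
      · rfl
  have hc0 : 4 * volume (square L) ≠ 0 := mul_ne_zero (by norm_num) (volume_square_ne_zero hL)
  have hc1 : 4 * volume (square L) ≠ ⊤ :=
    ENNReal.mul_ne_top (by norm_num) (volume_square_ne_top L)
  have hmap : ((4 * volume (square L)) • nodeLaw L).map (shiftNode L v τ s) =
      (4 * volume (square L)) • nodeLaw L := by
    conv_lhs => rw [← hU.map_eq, Measure.map_map hm hU.measurable, Measure.map_congr hcongr,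
      ← Measure.map_map hU.measurable hskew.measurable, hskew.map_eq, hU.map_eq]
  have h := MeasurePreserving.smul_measure ⟨hm, hmap⟩ (4 * volume (square L))⁻¹
  rwa [smul_smul, ENNReal.inv_mul_cancel hc0 hc1, one_smul] at h

/-! ### Meetings and the passage of time -/

/-- The beginnings, in the time set `I`, of the meetings with duration in `D`. -/
def meetings (R : ℝ) (a b : ℝ → Plane) (I : Set ℝ) (D : Set ℝ≥0∞) : Set ℝ :=
  {s | s ∈ I ∧ MeetingBegins R a b s ∧ meetingDuration R a b s ∈ D}

/-- The number of meetings in the network that begin in the time set `I` and have duration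
in `D`. -/
def totalMeetings {n : ℕ} (L v τ R : ℝ) (I : Set ℝ) (D : Set ℝ≥0∞) (ω : Fin n → NodeSample) :
    ℝ≥0∞ :=
  ∑ i, ∑ j ∈ Finset.Ioi i, ((meetings R (path L v τ (ω i)) (path L v τ (ω j)) I D).encard : ℝ≥0∞)

theorem expectedMeetings_eq (n : ℕ) (L v τ R h : ℝ) (D : Set ℝ≥0∞) :
    expectedMeetings n L v τ R h D =
      ∫⁻ ω, totalMeetings L v τ R (Set.Ioc 0 h) D ω ∂networkLaw n L := rfl

theorem meetingBegins_shift {R s x : ℝ} {a b a' b' : ℝ → Plane}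
    (ha : ∀ u, 0 ≤ u → a' u = a (s + u)) (hb : ∀ u, 0 ≤ u → b' u = b (s + u)) (hx : 0 < x) :
    MeetingBegins R a' b' x ↔ MeetingBegins R a b (s + x) := by
  unfold MeetingBegins
  rw [ha x hx.le, hb x hx.le]
  refine and_congr_right fun _ => ?_
  rw [(nhdsLT_basis x).eventually_iff, (nhdsLT_basis (s + x)).eventually_iff]
  constructor
  · rintro ⟨l, hl, h⟩
    refine ⟨s + max l 0, by simpa using ⟨hl, hx⟩, fun w hw => ?_⟩
    have hw' : max l 0 < w - s := by linarith [hw.1]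
    have := h (x := w - s) ⟨(le_max_left _ _).trans_lt hw', by linarith [hw.2]⟩
    have h0 : 0 ≤ w - s := (le_max_right l 0).trans hw'.le
    rwa [ha _ h0, hb _ h0, add_sub_cancel] at this
  · rintro ⟨l, hl, h⟩
    refine ⟨max (l - s) 0, max_lt (by linarith) hx, fun w hw => ?_⟩
    have h0 : 0 ≤ w := (le_max_right (l - s) 0).trans hw.1.le
    rw [ha _ h0, hb _ h0]
    exact h ⟨by linarith [(le_max_left (l - s) 0).trans_lt hw.1], by linarith [hw.2]⟩

theorem meetingDuration_shift {R s x : ℝ} {a b a' b' : ℝ → Plane}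
    (ha : ∀ u, 0 ≤ u → a' u = a (s + u)) (hb : ∀ u, 0 ≤ u → b' u = b (s + u)) (hx : 0 ≤ x) :
    meetingDuration R a' b' x = meetingDuration R a b (s + x) := by
  unfold meetingDuration
  refine iSup_congr fun u => iSup_congr_Prop ?_ fun _ => rfl
  constructor
  · intro h r hr
    have h0 : 0 ≤ r - s := by linarith [hr.1]
    have := h (r - s) ⟨by linarith [hr.1], by linarith [hr.2]⟩
    rwa [ha _ h0, hb _ h0, add_sub_cancel] at this
  · intro h r hr
    have h0 : 0 ≤ r := hx.trans hr.1
    rw [ha _ h0, hb _ h0]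
    exact h _ ⟨by linarith [hr.1], by linarith [hr.2]⟩

theorem encard_meetings_shift {R s h : ℝ} {a b a' b' : ℝ → Plane} (D : Set ℝ≥0∞)
    (ha : ∀ u, 0 ≤ u → a' u = a (s + u)) (hb : ∀ u, 0 ≤ u → b' u = b (s + u)) :
    (meetings R a' b' (Set.Ioc 0 h) D).encard =
      (meetings R a b (Set.Ioc s (s + h)) D).encard := by
  have : meetings R a b (Set.Ioc s (s + h)) D =
      (fun x => s + x) '' meetings R a' b' (Set.Ioc 0 h) D := by
    ext x
    constructor
    · rintro ⟨h1, h2, h3⟩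
      have h0 : 0 < x - s := by linarith [h1.1]
      refine ⟨x - s, ⟨⟨h0, by linarith [h1.2]⟩, ?_, ?_⟩, by simp⟩
      · rw [meetingBegins_shift ha hb h0]; simpa using h2
      · rw [meetingDuration_shift ha hb h0.le]; simpa using h3
    · rintro ⟨x, ⟨h1, h2, h3⟩, rfl⟩
      refine ⟨⟨by linarith [h1.1], by linarith [h1.2]⟩, ?_, ?_⟩
      · rwa [← meetingBegins_shift ha hb h1.1]
      · rwa [← meetingDuration_shift ha hb h1.1.le]
  rw [this, (add_right_injective s).encard_image]

theorem encard_meetings_add (R : ℝ) (a b : ℝ → Plane) (D : Set ℝ≥0∞) {s h : ℝ} (hs : 0 ≤ s)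
    (hh : 0 ≤ h) : (meetings R a b (Set.Ioc 0 s) D).encard +
      (meetings R a b (Set.Ioc s (s + h)) D).encard =
        (meetings R a b (Set.Ioc 0 (s + h)) D).encard := by
  rw [← Set.encard_union_eq]
  · congr 1
    ext x
    simp only [meetings, Set.mem_union, Set.mem_ofPred_eq, ← or_and_right,
      ← Set.mem_union x, Set.Ioc_union_Ioc_eq_Ioc hs (show s ≤ s + h by linarith)]
  · rw [Set.disjoint_left]
    rintro x ⟨h1, -⟩ ⟨h2, -⟩
    exact absurd h1.2 (not_le.2 h2.1)

theorem isProbabilityMeasure_nodeLaw {L : ℝ} (hL : 0 < L) : IsProbabilityMeasure (nodeLaw L) := by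
  have : IsProbabilityMeasure (volume[|square L] : Measure Plane) :=
    cond_isProbabilityMeasure_of_finite (volume_square_ne_zero hL) (volume_square_ne_top L)
  unfold nodeLaw
  infer_instance

theorem measurePreserving_snd_nodeLaw {L : ℝ} (hL : 0 < L) :
    MeasurePreserving Prod.snd (nodeLaw L) driveLaw := by
  have : IsProbabilityMeasure (volume[|square L] : Measure Plane) :=
    cond_isProbabilityMeasure_of_finite (volume_square_ne_zero hL) (volume_square_ne_top L)
  exact measurePreserving_snd

theorem measurePreserving_eval_network (n : ℕ) {L : ℝ} (hL : 0 < L) (i : Fin n) :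
    MeasurePreserving (fun ω : Fin n → NodeSample => ω i) (networkLaw n L) (nodeLaw L) := by
  have := isProbabilityMeasure_nodeLaw hL
  exact measurePreserving_eval _ i

theorem measurePreserving_gaps {L : ℝ} (hL : 0 < L) :
    MeasurePreserving (fun ω : NodeSample => ω.2.2) (nodeLaw L) (iidLaw gapLaw) :=
  measurePreserving_snd.comp (measurePreserving_snd_nodeLaw hL)

theorem ae_network_goodGaps (n : ℕ) {L : ℝ} (hL : 0 < L) :
    ∀ᵐ ω ∂networkLaw n L, ∀ i, (ω i).2.2 ∈ goodGaps :=
  ae_all_iff.2 fun i => ((measurePreserving_gaps hL).comp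
    (measurePreserving_eval_network n hL i)).quasiMeasurePreserving.ae ae_goodGaps

/-- The sample of the network seen from time `s` onwards. -/
def shiftNetwork {n : ℕ} (L v τ s : ℝ) (ω : Fin n → NodeSample) : Fin n → NodeSample :=
  fun i => shiftNode L v τ s (ω i)

theorem measurePreserving_shiftNetwork (n : ℕ) {L : ℝ} (hL : 0 < L) (v : ℝ) {τ s : ℝ}
    (hτ : 0 ≤ τ) (hs : 0 ≤ s) :
    MeasurePreserving (shiftNetwork L v τ s) (networkLaw n L) (networkLaw n L) := by
  have := isProbabilityMeasure_nodeLaw hL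
  exact measurePreserving_pi _ _ fun _ => measurePreserving_shiftNode hL v hτ hs

/-- Stationarity of the number of meetings, as an inequality for lower integrals. -/
theorem lintegral_totalMeetings_shift (n : ℕ) {L : ℝ} (hL : 0 < L) (v : ℝ) {τ s : ℝ}
    (hτ : 0 ≤ τ) (hs : 0 ≤ s) (R h : ℝ) (D : Set ℝ≥0∞) :
    ∫⁻ ω, totalMeetings L v τ R (Set.Ioc 0 h) D ω ∂networkLaw n L ≤
      ∫⁻ ω, totalMeetings L v τ R (Set.Ioc s (s + h)) D ω ∂networkLaw n L := by
  conv_lhs => rw [← (measurePreserving_shiftNetwork n hL v hτ hs).map_eq]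
  refine (lintegral_map_le _ _).trans (lintegral_mono_ae ?_)
  filter_upwards [ae_network_goodGaps n hL] with ω hω
  refine le_of_eq (Finset.sum_congr rfl fun i _ => Finset.sum_congr rfl fun j _ => ?_)
  exact congrArg _ (encard_meetings_shift D (fun u hu => path_shiftNode hL v hτ (hω i) s hu)
    (fun u hu => path_shiftNode hL v hτ (hω j) s hu))

/-- The expected number of meetings is superadditive in the length of the time window. The number
of meetings is not known to be measurable here; superadditivity of the lower integral suffices. -/
theorem mul_expectedMeetings_le (n : ℕ) {L : ℝ} (hL : 0 < L) (v : ℝ) {τ h : ℝ}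
    (hτ : 0 ≤ τ) (hh : 0 ≤ h) (R : ℝ) (D : Set ℝ≥0∞) (m : ℕ) :
    m * expectedMeetings n L v τ R h D ≤ expectedMeetings n L v τ R (m * h) D := by
  simp only [expectedMeetings_eq]
  induction m with
  | zero => simp
  | succ m ih =>
    have hs : (0 : ℝ) ≤ m * h := by positivity
    have e : ((m + 1 : ℕ) : ℝ) * h = m * h + h := by push_cast; ring
    rw [e, Nat.cast_succ, add_mul, one_mul]
    refine (add_le_add ih (lintegral_totalMeetings_shift n hL v hτ hs R h D)).trans
      ((le_lintegral_add _ _).trans (le_of_eq (lintegral_congr fun ω => ?_)))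
    unfold totalMeetings
    rw [← Finset.sum_add_distrib]
    refine Finset.sum_congr rfl fun i _ => ?_
    rw [← Finset.sum_add_distrib]
    refine Finset.sum_congr rfl fun j _ => ?_
    rw [← encard_meetings_add _ _ _ _ hs hh]
    simp

/-! ### Long meetings -/

theorem dist_le_of_le_duration {R s t : ℝ} {a b : ℝ → Plane}
    (h : ENNReal.ofReal t ≤ meetingDuration R a b s) {r : ℝ} (hr : r ∈ Set.Ico s (s + t)) :
    dist (a r) (b r) ≤ R := by
  have h1 : ENNReal.ofReal (r - s) < meetingDuration R a b s := by
    refine lt_of_lt_of_le ?_ h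
    rw [ENNReal.ofReal_lt_ofReal_iff (by linarith [hr.1, hr.2])]
    linarith [hr.2]
  unfold meetingDuration at h1
  simp only [lt_iSup_iff] at h1
  obtain ⟨u, hu, hlt⟩ := h1
  refine hu r ⟨hr.1, ?_⟩
  have : r - s < u := by
    rw [← ENNReal.ofReal_coe_nnreal] at hlt
    exact (ENNReal.ofReal_lt_ofReal_iff_of_nonneg (by linarith [hr.1])).1 hlt
  linarith

/-- Meetings of duration at least `t` are at least as rare as the multiples of `t` at which the two
points are within distance `R`: each such meeting contains such a multiple, and different meetings
contain different ones. -/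
theorem encard_long_meetings_le {R t : ℝ} (ht : 0 < t) (a b : ℝ → Plane) (T : ℝ) :
    ((meetings R a b (Set.Ioc 0 T) (Set.Ici (ENNReal.ofReal t))).encard : ℝ≥0∞) ≤
      ∑ k ∈ Finset.range (⌈T / t⌉₊ + 1),
        if dist (a (k * t)) (b (k * t)) ≤ R then (1 : ℝ≥0∞) else 0 := by
  classical
  set S := meetings R a b (Set.Ioc 0 T) (Set.Ici (ENNReal.ofReal t)) with hS
  have hceil : ∀ s ∈ S, (⌈s / t⌉₊ : ℝ) * t ∈ Set.Ico s (s + t) := by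
    intro s hs
    have h1 := Nat.le_ceil (s / t)
    have h2 := Nat.ceil_lt_add_one (div_nonneg hs.1.1.le ht.le)
    rw [div_le_iff₀ ht] at h1
    refine ⟨h1, ?_⟩
    have := mul_lt_mul_of_pos_right h2 ht
    rwa [add_mul, one_mul, div_mul_cancel₀ _ ht.ne'] at this
  have hlt : ∀ s ∈ S, ∀ s' ∈ S, ⌈s / t⌉₊ = ⌈s' / t⌉₊ → ¬ s < s' := by
    intro s hs s' hs' he hss
    have h1 := (hceil s hs).2
    rw [he] at h1
    have h2 := (hceil s' hs').1
    obtain ⟨l, hl, hlr⟩ := (nhdsLT_basis s').eventually_iff.1 hs'.2.1.2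
    obtain ⟨r, hr1, hr2⟩ := exists_between (max_lt hl hss)
    have h3 := hlr ⟨(le_max_left _ _).trans_lt hr1, hr2⟩
    have h4 := dist_le_of_le_duration hs.2.2
      (r := r) ⟨((le_max_right _ _).trans_lt hr1).le, by linarith⟩
    exact absurd h3 (not_lt.2 h4)
  have hinj : Set.InjOn (fun s => ⌈s / t⌉₊) S := by
    intro s hs s' hs' he
    exact le_antisymm (not_lt.1 (hlt s' hs' s hs he.symm)) (not_lt.1 (hlt s hs s' hs' he))
  have hmaps : Set.MapsTo (fun s => ⌈s / t⌉₊) S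
      (((Finset.range (⌈T / t⌉₊ + 1)).filter fun k : ℕ =>
        dist (a (k * t)) (b (k * t)) ≤ R : Finset ℕ) : Set ℕ) := by
    intro s hs
    simp only [Finset.coe_filter, Finset.mem_range, Set.mem_ofPred_eq, Nat.lt_succ_iff]
    exact ⟨Nat.ceil_mono (div_le_div_of_nonneg_right hs.1.2 ht.le),
      dist_le_of_le_duration hs.2.2 (hceil s hs)⟩
  have h := Set.encard_le_encard_of_injOn hmaps hinj
  rw [Set.encard_coe_eq_coe_finsetCard] at h
  refine (ENat.toENNReal_le.2 h).trans (le_of_eq ?_)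
  rw [Finset.sum_boole]
  simp

theorem measurePreserving_pair (n : ℕ) {L : ℝ} (hL : 0 < L) {i j : Fin n} (hij : i ≠ j) :
    MeasurePreserving (fun ω : Fin n → NodeSample => (ω i, ω j)) (networkLaw n L)
      ((nodeLaw L).prod (nodeLaw L)) := by
  have := isProbabilityMeasure_nodeLaw hL
  have : IsProbabilityMeasure (networkLaw n L) := by unfold networkLaw; infer_instance
  have h1 : iIndepFun (fun i (ω : Fin n → NodeSample) => ω i) (networkLaw n L) :=
    iIndepFun_pi (X := fun _ => id) (fun _ => aemeasurable_id)
  have h2 := (indepFun_iff_map_prod_eq_prod_map_map (measurable_pi_apply i).aemeasurable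
    (measurable_pi_apply j).aemeasurable).1
    (h1.indepFun hij)
  refine ⟨(measurable_pi_apply i).prodMk (measurable_pi_apply j), ?_⟩
  rw [h2, (measurePreserving_eval_network n hL i).map_eq,
    (measurePreserving_eval_network n hL j).map_eq]

/-- At a fixed time, two nodes are within distance `R` with probability at most `π R² / L²`. -/
theorem networkLaw_dist_le (n : ℕ) {L : ℝ} (hL : 0 < L) (R : ℝ) {i j : Fin n}
    (hij : i ≠ j) : networkLaw n L {ω | dist (ω i).1 (ω j).1 ≤ R} ≤
      ENNReal.ofReal R ^ 2 * ENNReal.ofReal Real.pi / volume (square L) := by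
  have := isProbabilityMeasure_nodeLaw hL
  have hm : MeasurableSet {q : NodeSample × NodeSample | dist q.1.1 q.2.1 ≤ R} :=
    measurableSet_le (by fun_prop) measurable_const
  have h1 := (measurePreserving_pair n hL hij).measure_preimage hm.nullMeasurableSet
  refine le_trans (le_of_eq h1) ?_
  rw [Measure.prod_apply_symm hm]
  have h2 : ∀ ω : NodeSample, nodeLaw L ((fun x => (x, ω)) ⁻¹'
      {q : NodeSample × NodeSample | dist q.1.1 q.2.1 ≤ R}) ≤
        ENNReal.ofReal R ^ 2 * ENNReal.ofReal Real.pi / volume (square L) := by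
    intro ω
    have e : (fun x => (x, ω)) ⁻¹' {q : NodeSample × NodeSample | dist q.1.1 q.2.1 ≤ R} =
        Metric.closedBall ω.1 R ×ˢ Set.univ := by
      ext x; simp
    rw [e, nodeLaw, Measure.prod_prod, measure_univ, mul_one,
      cond_apply (measurableSet_square L), mul_comm, ← div_eq_mul_inv]
    refine ENNReal.div_le_div_right ((measure_mono Set.inter_subset_right).trans (le_of_eq ?_)) _
    exact EuclideanSpace.volume_closedBall_fin_two _ _
  refine (lintegral_mono h2).trans ?_
  simp

/-- The number of pairs of nodes. -/
def pairCount (n : ℕ) : ℝ≥0∞ := ∑ i : Fin n, ∑ _j ∈ Finset.Ioi i, 1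

theorem pairCount_ne_top (n : ℕ) : pairCount n ≠ ⊤ := by
  simp [pairCount, ENNReal.sum_eq_top]

/-- The expected number of meetings of duration at least `t` is at most the expected time spent in
meetings, divided by `t`. -/
theorem expectedMeetings_Ici_le (n : ℕ) {L : ℝ} (hL : 0 < L) (v : ℝ) {τ h t : ℝ}
    (hτ : 0 ≤ τ) (hh : 0 < h) (ht : 0 < t) (R : ℝ) :
    expectedMeetings n L v τ R h (Set.Ici (ENNReal.ofReal t)) ≤
      pairCount n * (ENNReal.ofReal R ^ 2 * ENNReal.ofReal Real.pi / volume (square L)) *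
        ENNReal.ofReal (h / t) := by
  set P := ENNReal.ofReal R ^ 2 * ENNReal.ofReal Real.pi / volume (square L) with hP
  have hbound : ∀ T : ℝ, expectedMeetings n L v τ R T (Set.Ici (ENNReal.ofReal t)) ≤
      pairCount n * P * (⌈T / t⌉₊ + 1 : ℕ) := by
    intro T
    rw [expectedMeetings_eq]
    have hmeas : ∀ (i j : Fin n) (k : ℕ), MeasurableSet {ω : Fin n → NodeSample |
        dist (path L v τ (ω i) (k * t)) (path L v τ (ω j) (k * t)) ≤ R} := fun i j k =>
      measurableSet_le (((measurable_path L v τ _).comp (measurable_pi_apply i)).dist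
        ((measurable_path L v τ _).comp (measurable_pi_apply j))) measurable_const
    have hmeas' : ∀ (i j : Fin n) (k : ℕ), Measurable fun ω : Fin n → NodeSample =>
        if dist (path L v τ (ω i) (k * t)) (path L v τ (ω j) (k * t)) ≤ R then (1 : ℝ≥0∞)
          else 0 := fun i j k => Measurable.ite (hmeas i j k) measurable_const measurable_const
    refine (lintegral_mono fun ω => Finset.sum_le_sum fun i _ => Finset.sum_le_sum fun j _ =>
      encard_long_meetings_le ht _ _ T).trans ?_
    rw [lintegral_finsetSum _ fun i _ => Finset.measurable_sum _ fun j _ =>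
      Finset.measurable_sum _ fun k _ => hmeas' i j k, pairCount, Finset.sum_mul, Finset.sum_mul]
    refine Finset.sum_le_sum fun i _ => ?_
    rw [lintegral_finsetSum _ fun j _ => Finset.measurable_sum _ fun k _ => hmeas' i j k,
      Finset.sum_mul, Finset.sum_mul]
    refine Finset.sum_le_sum fun j hj => ?_
    rw [lintegral_finsetSum _ fun k _ => hmeas' i j k, one_mul]
    have hk : ∀ k ∈ Finset.range (⌈T / t⌉₊ + 1), ∫⁻ ω : Fin n → NodeSample,
        (if dist (path L v τ (ω i) (k * t)) (path L v τ (ω j) (k * t)) ≤ R then (1 : ℝ≥0∞)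
          else 0) ∂networkLaw n L ≤ P := by
      intro k _
      have hpres := measurePreserving_shiftNetwork n hL v hτ
        (show (0 : ℝ) ≤ k * t by positivity)
      have h1 := hpres.measure_preimage (s := {ω | dist (ω i).1 (ω j).1 ≤ R})
        (measurableSet_le (by fun_prop) measurable_const).nullMeasurableSet
      have h2 : ∫⁻ ω : Fin n → NodeSample,
          (if dist (path L v τ (ω i) (k * t)) (path L v τ (ω j) (k * t)) ≤ R then (1 : ℝ≥0∞)
            else 0) ∂networkLaw n L = networkLaw n L {ω |
              dist (path L v τ (ω i) (k * t)) (path L v τ (ω j) (k * t)) ≤ R} := by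
        rw [← lintegral_indicator_one (hmeas i j k)]
        refine lintegral_congr fun ω => ?_
        simp only [Set.indicator_apply, Set.mem_ofPred_eq, Pi.one_apply]
      rw [h2]
      exact (le_of_eq h1).trans
        (networkLaw_dist_le n hL R (Finset.mem_Ioi.1 hj).ne)
    refine (Finset.sum_le_sum hk).trans (le_of_eq ?_)
    rw [Finset.sum_const, Finset.card_range, nsmul_eq_mul, mul_comm]
  -- In a window of length `m h` the rounding of `m h / t` costs a bounded number of multiples of
  -- `t`, which becomes negligible as `m → ∞`.
  have hle : ∀ m : ℕ, expectedMeetings n L v τ R h (Set.Ici (ENNReal.ofReal t)) ≤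
      pairCount n * P * ENNReal.ofReal (h / t + 2 / (m + 1 : ℕ)) := by
    intro m
    have h1 := (mul_expectedMeetings_le n hL v hτ hh.le R (Set.Ici (ENNReal.ofReal t))
      (m + 1)).trans (hbound _)
    have hm : ((m + 1 : ℕ) : ℝ≥0∞) ≠ 0 := by simp
    have hm' : ((m + 1 : ℕ) : ℝ≥0∞) ≠ ⊤ := ENNReal.natCast_ne_top _
    have h2 : ((⌈((m + 1 : ℕ) : ℝ) * h / t⌉₊ + 1 : ℕ) : ℝ≥0∞) ≤
        ((m + 1 : ℕ) : ℝ≥0∞) * ENNReal.ofReal (h / t + 2 / (m + 1 : ℕ)) := by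
      rw [← ENNReal.ofReal_natCast, ← ENNReal.ofReal_natCast, ← ENNReal.ofReal_mul (by positivity)]
      refine ENNReal.ofReal_le_ofReal ?_
      have := Nat.ceil_lt_add_one (show 0 ≤ ((m + 1 : ℕ) : ℝ) * h / t by positivity)
      have e : ((m + 1 : ℕ) : ℝ) * (h / t + 2 / (m + 1 : ℕ)) = ((m + 1 : ℕ) : ℝ) * h / t + 2 := by
        field_simp
      rw [e, Nat.cast_succ]
      linarith
    have h3 := h1.trans (mul_le_mul_right h2 (pairCount n * P))
    rw [← mul_assoc, mul_comm (pairCount n * P), mul_assoc] at h3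
    exact (ENNReal.mul_le_mul_iff_right hm hm').1 h3
  have hPtop : P ≠ ⊤ := ENNReal.div_ne_top (ENNReal.mul_ne_top
    (ENNReal.pow_ne_top ENNReal.ofReal_ne_top) ENNReal.ofReal_ne_top) (volume_square_ne_zero hL)
  have htend : Filter.Tendsto (fun m : ℕ => pairCount n * P *
      ENNReal.ofReal (h / t + 2 / (m + 1 : ℕ))) Filter.atTop
        (𝓝 (pairCount n * P * ENNReal.ofReal (h / t))) := by
    refine ENNReal.Tendsto.const_mul (ENNReal.tendsto_ofReal ?_) (Or.inr (ENNReal.mul_ne_top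
      (pairCount_ne_top n) hPtop))
    have h1 : Filter.Tendsto (fun m : ℕ => (2 : ℝ) / (m + 1 : ℕ)) Filter.atTop (𝓝 0) :=
      (Filter.tendsto_add_atTop_iff_nat 1).2 (tendsto_const_div_atTop_nhds_zero_nat (2 : ℝ))
    simpa using h1.const_add (h / t)
  exact ge_of_tendsto' htend hle

/-! ### Finiteness of the expected number of meetings -/

/-- The number of direction changes up to time `s` and the cell of the lattice `L ℤ²` in which the
free path lies at that time. Between two times with the same code the node moves uniformly along a
straight line, without reflection. -/
def nodeCode (L v τ : ℝ) (ω : NodeSample) (s : ℝ) : ℕ × ℤ × ℤ :=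
  (count ω.2.2 (τ * s), ⌊(ω.1 0 + displ Real.cos v τ ω.2 s) / L⌋,
    ⌊(ω.1 1 + displ Real.sin v τ ω.2 s) / L⌋)

/-- Between two times with the same number of direction changes the motion is uniform. -/
theorem displ_convex_comb {F : ℝ → ℝ} (hFm : Measurable F) (hF : ∀ x, |F x| ≤ 1) (v : ℝ) {τ : ℝ}
    (hτ : 0 ≤ τ) {y : (ℕ → ℝ) × (ℕ → ℝ)} (hy : y.2 ∈ goodGaps) {s s' α β : ℝ} (hs : s ≤ s')
    (hcount : count y.2 (τ * s) = count y.2 (τ * s')) (hα : 0 ≤ α) (hβ : 0 ≤ β)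
    (hαβ : α + β = 1) :
    displ F v τ y (α * s + β * s') = α * displ F v τ y s + β * displ F v τ y s' := by
  have hk : ∀ u ∈ Set.Icc s s', count y.2 (τ * u) = count y.2 (τ * s) := fun u hu =>
    le_antisymm (hcount ▸ count_mono hy (mul_le_mul_of_nonneg_left hu.2 hτ))
      (count_mono hy (mul_le_mul_of_nonneg_left hu.1 hτ))
  obtain rfl : α = 1 - β := by linarith
  have h1 : s ≤ (1 - β) * s + β * s' := by nlinarith
  have h2 : (1 - β) * s + β * s' ≤ s' := by nlinarith
  have e1 := displ_sub_of_count_eq hFm hF v τ y h1 fun u hu => hk u ⟨hu.1, hu.2.trans h2⟩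
  have e2 := displ_sub_of_count_eq hFm hF v τ y hs hk
  linear_combination e1 - β * e2

theorem path_convex_comb {L : ℝ} (hL : 0 < L) (v : ℝ) {τ : ℝ} (hτ : 0 ≤ τ) {ω : NodeSample}
    (hω : ω.2.2 ∈ goodGaps) {s s' α β : ℝ} (hs : s ≤ s')
    (hcode : nodeCode L v τ ω s = nodeCode L v τ ω s') (hα : 0 ≤ α) (hβ : 0 ≤ β)
    (hαβ : α + β = 1) :
    path L v τ ω (α * s + β * s') = α • path L v τ ω s + β • path L v τ ω s' := by
  have hc : count ω.2.2 (τ * s) = count ω.2.2 (τ * s') := congrArg Prod.fst hcode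
  have h0 : ⌊(ω.1 0 + displ Real.cos v τ ω.2 s) / L⌋ = ⌊(ω.1 0 + displ Real.cos v τ ω.2 s') / L⌋ :=
    congrArg (fun q => q.2.1) hcode
  have h1 : ⌊(ω.1 1 + displ Real.sin v τ ω.2 s) / L⌋ = ⌊(ω.1 1 + displ Real.sin v τ ω.2 s') / L⌋ :=
    congrArg (fun q => q.2.2) hcode
  have e0 := fold_convex_comb hL h0 hα hβ hαβ
  have e1 := fold_convex_comb hL h1 hα hβ hαβ
  rw [path_eq, path_eq, path_eq,
    displ_convex_comb Real.measurable_cos Real.abs_cos_le_one v hτ hω hs hc hα hβ hαβ,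
    displ_convex_comb Real.measurable_sin Real.abs_sin_le_one v hτ hω hs hc hα hβ hαβ]
  ext i
  fin_cases i
  · simp only [Fin.zero_eta, PiLp.add_apply, PiLp.smul_apply, smul_eq_mul]
    simp only [Matrix.cons_val_zero]
    rw [← e0]
    congr 1
    linear_combination -ω.1 0 * hαβ
  · simp only [Fin.mk_one, PiLp.add_apply, PiLp.smul_apply, smul_eq_mul]
    simp only [Matrix.cons_val_one, Matrix.cons_val_fin_one]
    rw [← e1]
    congr 1
    linear_combination -ω.1 1 * hαβ

/-- Two meetings that begin at different times have different codes, because the distance is convex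
along uniform motions. -/
theorem injOn_nodeCode {L : ℝ} (hL : 0 < L) (v : ℝ) {τ : ℝ} (hτ : 0 ≤ τ) (R h : ℝ)
    {ω ω' : NodeSample} (hω : ω.2.2 ∈ goodGaps) (hω' : ω'.2.2 ∈ goodGaps) (D : Set ℝ≥0∞) :
    Set.InjOn (fun s => (nodeCode L v τ ω s, nodeCode L v τ ω' s))
      (meetings R (path L v τ ω) (path L v τ ω') (Set.Ioc 0 h) D) := by
  have key : ∀ s ∈ meetings R (path L v τ ω) (path L v τ ω') (Set.Ioc 0 h) D,
      ∀ s' ∈ meetings R (path L v τ ω) (path L v τ ω') (Set.Ioc 0 h) D,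
      (nodeCode L v τ ω s, nodeCode L v τ ω' s) = (nodeCode L v τ ω s', nodeCode L v τ ω' s') →
      ¬ s < s' := by
    intro s hs s' hs' he hlt
    rw [Prod.mk.injEq] at he
    obtain ⟨l, hl, hlr⟩ := (nhdsLT_basis s').eventually_iff.1 hs'.2.1.2
    obtain ⟨r, hr1, hr2⟩ := exists_between (max_lt hl hlt)
    have h3 := hlr ⟨(le_max_left _ _).trans_lt hr1, hr2⟩
    have hsr : s < r := (le_max_right _ _).trans_lt hr1
    obtain ⟨α, β, hα, hβ, hαβ, hr⟩ := (Convex.mem_Icc hlt.le).1 ⟨hsr.le, hr2.le⟩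
    rw [← hr, path_convex_comb hL v hτ hω hlt.le he.1 hα hβ hαβ,
      path_convex_comb hL v hτ hω' hlt.le he.2 hα hβ hαβ, dist_eq_norm] at h3
    have h4 := hs.2.1.1
    have h5 := hs'.2.1.1
    rw [dist_eq_norm] at h4 h5
    have h6 : α • path L v τ ω s + β • path L v τ ω s' -
        (α • path L v τ ω' s + β • path L v τ ω' s') =
        α • (path L v τ ω s - path L v τ ω' s) + β • (path L v τ ω s' - path L v τ ω' s') := by
      module
    rw [h6] at h3
    have h7 := norm_add_le (α • (path L v τ ω s - path L v τ ω' s))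
      (β • (path L v τ ω s' - path L v τ ω' s'))
    rw [norm_smul, norm_smul, Real.norm_of_nonneg hα, Real.norm_of_nonneg hβ] at h7
    have h8 : R = α * R + β * R := by rw [← add_mul, hαβ, one_mul]
    have h9 := mul_le_mul_of_nonneg_left h4 hα
    have h10 := mul_le_mul_of_nonneg_left h5 hβ
    linarith
  intro s hs s' hs' he
  exact le_antisymm (not_lt.1 (key s' hs' s hs he.symm)) (not_lt.1 (key s hs s' hs' he))

/-- The cells that a coordinate of the free path may visit in the time window `[0, h]`. -/
def cells (L v h : ℝ) : Finset ℤ := Finset.Icc ⌊-(|v| * h / L)⌋ ⌊1 + |v| * h / L⌋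

theorem floor_mem_cells {L : ℝ} (hL : 0 < L) {v h s x d : ℝ} (hs : s ∈ Set.Icc 0 h)
    (hx : x ∈ Set.Icc 0 L) (hd : |d| ≤ |v| * |s|) : ⌊(x + d) / L⌋ ∈ cells L v h := by
  rw [abs_of_nonneg hs.1] at hd
  have h1 := abs_le.1 (hd.trans (mul_le_mul_of_nonneg_left hs.2 (abs_nonneg v)))
  have h2 : |v| * h / L * L = |v| * h := div_mul_cancel₀ _ hL.ne'
  refine Finset.mem_Icc.2 ⟨Int.floor_mono ?_, Int.floor_mono ?_⟩
  · rw [le_div_iff₀ hL]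
    linarith [hx.1]
  · rw [div_le_iff₀ hL]
    linarith [hx.2]

theorem encard_meetings_le {L : ℝ} (hL : 0 < L) (v : ℝ) {τ : ℝ} (hτ : 0 ≤ τ) (R h : ℝ)
    {ω ω' : NodeSample} (hω : ω.2.2 ∈ goodGaps) (hω' : ω'.2.2 ∈ goodGaps) (hx : ω.1 ∈ square L)
    (hx' : ω'.1 ∈ square L) (D : Set ℝ≥0∞) :
    ((meetings R (path L v τ ω) (path L v τ ω') (Set.Ioc 0 h) D).encard : ℝ≥0∞) ≤
      (cells L v h).card ^ 4 * (((count ω.2.2 (τ * h) + 1 : ℕ) : ℝ≥0∞) ^ 2 +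
        ((count ω'.2.2 (τ * h) + 1 : ℕ) : ℝ≥0∞) ^ 2) := by
  have hmem : ∀ {ω : NodeSample}, ω.2.2 ∈ goodGaps → ω.1 ∈ square L → ∀ s ∈ Set.Ioc 0 h,
      nodeCode L v τ ω s ∈ Finset.range (count ω.2.2 (τ * h) + 1) ×ˢ
        (cells L v h ×ˢ cells L v h) := by
    intro ω hω hx s hs
    have hs' : s ∈ Set.Icc 0 h := ⟨hs.1.le, hs.2⟩
    refine Finset.mem_product.2 ⟨?_, Finset.mem_product.2 ⟨?_, ?_⟩⟩
    · exact Finset.mem_range.2 (Nat.lt_succ_of_le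
        (count_mono hω (mul_le_mul_of_nonneg_left hs.2 hτ)))
    · exact floor_mem_cells hL hs' (hx 0) (abs_displ_le Real.abs_cos_le_one v τ _ s)
    · exact floor_mem_cells hL hs' (hx 1) (abs_displ_le Real.abs_sin_le_one v τ _ s)
  have hmaps : Set.MapsTo (fun s => (nodeCode L v τ ω s, nodeCode L v τ ω' s))
      (meetings R (path L v τ ω) (path L v τ ω') (Set.Ioc 0 h) D)
      (((Finset.range (count ω.2.2 (τ * h) + 1) ×ˢ (cells L v h ×ˢ cells L v h)) ×ˢ
        (Finset.range (count ω'.2.2 (τ * h) + 1) ×ˢ (cells L v h ×ˢ cells L v h)) :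
          Finset ((ℕ × ℤ × ℤ) × (ℕ × ℤ × ℤ))) : Set ((ℕ × ℤ × ℤ) × (ℕ × ℤ × ℤ))) := fun s hs =>
    Finset.mem_coe.2 (Finset.mem_product.2 ⟨hmem hω hx s hs.1, hmem hω' hx' s hs.1⟩)
  have hle := Set.encard_le_encard_of_injOn hmaps (injOn_nodeCode hL v hτ R h hω hω' D)
  rw [Set.encard_coe_eq_coe_finsetCard] at hle
  refine (ENat.toENNReal_le.2 hle).trans ?_
  simp only [Finset.card_product, Finset.card_range, ENat.toENNReal_coe]
  have : ∀ J a b : ℕ, a * (J * J) * (b * (J * J)) ≤ J ^ 4 * (a ^ 2 + b ^ 2) := by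
    intro J a b
    have h1 : a * b ≤ a ^ 2 + b ^ 2 := by
      rcases le_total a b with h | h <;> nlinarith
    calc a * (J * J) * (b * (J * J)) = J ^ 4 * (a * b) := by ring
      _ ≤ _ := Nat.mul_le_mul_left _ h1
  exact_mod_cast this _ _ _

/-- The number of points of the Poisson process in a bounded interval has a finite second
moment. -/
theorem lintegral_count_sq_ne_top {c : ℝ} (hc : 0 ≤ c) :
    ∫⁻ g, ((count g c + 1 : ℕ) : ℝ≥0∞) ^ 2 ∂iidLaw gapLaw ≠ ⊤ := by
  have hm : Measurable fun g : ℕ → ℝ => count g c :=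
    measurable_count.comp (measurable_id.prodMk measurable_const)
  have h1 : ∫⁻ g, ((count g c + 1 : ℕ) : ℝ≥0∞) ^ 2 ∂iidLaw gapLaw =
      ∫⁻ k, ((k + 1 : ℕ) : ℝ≥0∞) ^ 2 ∂(iidLaw gapLaw).map fun g => count g c :=
    (lintegral_map (f := fun k : ℕ => ((k + 1 : ℕ) : ℝ≥0∞) ^ 2) measurable_from_top hm).symm
  rw [h1, lintegral_countable']
  have h2 : ∀ k : ℕ, ((k + 1 : ℕ) : ℝ≥0∞) ^ 2 * (iidLaw gapLaw).map (fun g => count g c) {k} ≤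
      ENNReal.ofReal (Real.exp c * 2 * (((k + 1 : ℕ) : ℝ) ^ 2 * (1 / 2) ^ (k + 1))) := by
    intro k
    rw [Measure.map_apply hm (measurableSet_singleton k)]
    have h3 : iidLaw gapLaw ((fun g => count g c) ⁻¹' {k}) ≤
        ENNReal.ofReal (Real.exp c) * 2⁻¹ ^ k := by
      refine (measure_mono ?_).trans (iidLaw_firstPointsLE_le k hc)
      rintro g rfl
      exact mem_firstPointsLE_count g c
    refine (mul_le_mul_right h3 _).trans (le_of_eq ?_)
    rw [← ENNReal.ofReal_natCast, ← ENNReal.ofReal_pow (by positivity),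
      show (2⁻¹ : ℝ≥0∞) = ENNReal.ofReal (1 / 2) by
        rw [one_div, ENNReal.ofReal_inv_of_pos two_pos]; simp,
      ← ENNReal.ofReal_pow (by positivity), ← ENNReal.ofReal_mul (by positivity),
      ← ENNReal.ofReal_mul (by positivity)]
    congr 1
    rw [pow_succ (1 / 2 : ℝ) k]
    ring
  have hsum : Summable fun k : ℕ =>
      Real.exp c * 2 * (((k + 1 : ℕ) : ℝ) ^ 2 * (1 / 2 : ℝ) ^ (k + 1)) :=
    ((summable_nat_add_iff 1).2 (summable_pow_mul_geometric_of_norm_lt_one 2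
      (r := (1 / 2 : ℝ)) (by norm_num))).mul_left _
  exact ne_top_of_le_ne_top hsum.tsum_ofReal_ne_top (ENNReal.tsum_le_tsum h2)

theorem ae_network_mem_square (n : ℕ) {L : ℝ} (hL : 0 < L) :
    ∀ᵐ ω ∂networkLaw n L, ∀ i, (ω i).1 ∈ square L := by
  have h1 : ∀ᵐ ω ∂nodeLaw L, ω.1 ∈ square L :=
    Measure.quasiMeasurePreserving_fst.ae (ae_cond_mem (measurableSet_square L))
  exact ae_all_iff.2 fun i => (measurePreserving_eval_network n hL i).quasiMeasurePreserving.ae h1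

theorem expectedMeetings_ne_top (n : ℕ) {L : ℝ} (hL : 0 < L) (v : ℝ) {τ h : ℝ}
    (hτ : 0 ≤ τ) (hh : 0 ≤ h) (R : ℝ) (D : Set ℝ≥0∞) :
    expectedMeetings n L v τ R h D ≠ ⊤ := by
  rw [expectedMeetings_eq]
  set J : ℝ≥0∞ := ((cells L v h).card : ℝ≥0∞) ^ 4 with hJ
  have hJtop : J ≠ ⊤ := ENNReal.pow_ne_top (ENNReal.natCast_ne_top _)
  have hm : ∀ i : Fin n, Measurable fun ω : Fin n → NodeSample =>
      ((count (ω i).2.2 (τ * h) + 1 : ℕ) : ℝ≥0∞) ^ 2 := by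
    intro i
    have h1 : Measurable fun ω : Fin n → NodeSample => count (ω i).2.2 (τ * h) :=
      measurable_count.comp (f := fun ω : Fin n → NodeSample => ((ω i).2.2, τ * h)) (by fun_prop)
    exact (measurable_from_top (f := fun k : ℕ => ((k + 1 : ℕ) : ℝ≥0∞) ^ 2)).comp h1
  have hfin : ∀ i : Fin n, ∫⁻ ω, ((count (ω i).2.2 (τ * h) + 1 : ℕ) : ℝ≥0∞) ^ 2
      ∂networkLaw n L ≠ ⊤ := by
    intro i
    have hp := (measurePreserving_gaps hL).comp (measurePreserving_eval_network n hL i)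
    have hm' : Measurable fun g : ℕ → ℝ => ((count g (τ * h) + 1 : ℕ) : ℝ≥0∞) ^ 2 :=
      (measurable_from_top (f := fun k : ℕ => ((k + 1 : ℕ) : ℝ≥0∞) ^ 2)).comp
        (measurable_count.comp (measurable_id.prodMk measurable_const))
    have h2 := hp.lintegral_comp hm'
    exact (ne_of_eq_of_ne h2 (lintegral_count_sq_ne_top (mul_nonneg hτ hh)))
  have hbound : ∫⁻ ω, totalMeetings L v τ R (Set.Ioc 0 h) D ω ∂networkLaw n L ≤
      ∫⁻ ω, ∑ i : Fin n, ∑ j ∈ Finset.Ioi i, J * (((count (ω i).2.2 (τ * h) + 1 : ℕ) : ℝ≥0∞) ^ 2 +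
        ((count (ω j).2.2 (τ * h) + 1 : ℕ) : ℝ≥0∞) ^ 2) ∂networkLaw n L := by
    refine lintegral_mono_ae ?_
    filter_upwards [ae_network_goodGaps n hL, ae_network_mem_square n hL] with ω hω hx
    exact Finset.sum_le_sum fun i _ => Finset.sum_le_sum fun j _ =>
      encard_meetings_le hL v hτ R h (hω i) (hω j) (hx i) (hx j) D
  refine ne_top_of_le_ne_top ?_ hbound
  have hm2 : ∀ i j : Fin n, Measurable fun ω : Fin n → NodeSample =>
      J * (((count (ω i).2.2 (τ * h) + 1 : ℕ) : ℝ≥0∞) ^ 2 +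
        ((count (ω j).2.2 (τ * h) + 1 : ℕ) : ℝ≥0∞) ^ 2) := fun i j =>
    ((hm i).add (hm j)).const_mul J
  rw [lintegral_finsetSum _ fun i _ => Finset.measurable_sum _ fun j _ => hm2 i j]
  refine ENNReal.sum_ne_top.2 fun i _ => ?_
  rw [lintegral_finsetSum _ fun j _ => hm2 i j]
  refine ENNReal.sum_ne_top.2 fun j _ => ?_
  rw [lintegral_const_mul' _ _ hJtop, lintegral_add_left (hm i)]
  exact ENNReal.mul_ne_top hJtop (ENNReal.add_ne_top.2 ⟨hfin i, hfin j⟩)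

/-! ### The region swept by a moving disc -/

/-- The initial relative positions `D` from which the uniform relative motion with velocity `w`
enters the disc of radius `R` within time `δ`. With `q` the half length of the chord cut out by the
disc, times the speed, entering takes place when the inner product of position and velocity
reaches `-q`. -/
def sweep (R δ : ℝ) (w : ℝ × ℝ) : Set (ℝ × ℝ) :=
  {D | (D.1 * w.2 - D.2 * w.1) ^ 2 < R ^ 2 * (w.1 ^ 2 + w.2 ^ 2) ∧
    -√(R ^ 2 * (w.1 ^ 2 + w.2 ^ 2) - (D.1 * w.2 - D.2 * w.1) ^ 2) - δ * (w.1 ^ 2 + w.2 ^ 2) ≤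
      D.1 * w.1 + D.2 * w.2 ∧
    D.1 * w.1 + D.2 * w.2 <
      -√(R ^ 2 * (w.1 ^ 2 + w.2 ^ 2) - (D.1 * w.2 - D.2 * w.1) ^ 2)}

theorem measurableSet_sweep (R δ : ℝ) :
    MeasurableSet {q : (ℝ × ℝ) × (ℝ × ℝ) | q.1 ∈ sweep R δ q.2} := by
  have hc : Measurable fun q : (ℝ × ℝ) × (ℝ × ℝ) => (q.1.1 * q.2.2 - q.1.2 * q.2.1) ^ 2 := by
    fun_prop
  have hN : Measurable fun q : (ℝ × ℝ) × (ℝ × ℝ) => q.2.1 ^ 2 + q.2.2 ^ 2 := by fun_prop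
  have hp : Measurable fun q : (ℝ × ℝ) × (ℝ × ℝ) => q.1.1 * q.2.1 + q.1.2 * q.2.2 := by fun_prop
  have hq := (((hN.const_mul (R ^ 2)).sub hc).sqrt).neg
  exact (measurableSet_lt hc (hN.const_mul _)).inter ((measurableSet_le
    (hq.sub (hN.const_mul δ)) hp).inter (measurableSet_lt hp hq))

theorem exists_entrance {R δ : ℝ} {w D : ℝ × ℝ} (h : D ∈ sweep R δ w) :
    ∃ s ∈ Set.Ioc 0 δ, (D.1 + s * w.1) ^ 2 + (D.2 + s * w.2) ^ 2 = R ^ 2 ∧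
      ∀ u < s, R ^ 2 < (D.1 + u * w.1) ^ 2 + (D.2 + u * w.2) ^ 2 := by
  obtain ⟨h1, h2, h3⟩ := h
  set N := w.1 ^ 2 + w.2 ^ 2 with hN
  set c := D.1 * w.2 - D.2 * w.1 with hc
  set p := D.1 * w.1 + D.2 * w.2 with hp
  set q := √(R ^ 2 * N - c ^ 2) with hq
  have hN0 : 0 < N := by
    have hN0 : 0 ≤ N := by positivity
    rcases hN0.eq_or_lt with h | h
    · rw [← h] at h1; nlinarith [sq_nonneg c]
    · exact h
  have hqq : q ^ 2 = R ^ 2 * N - c ^ 2 := Real.sq_sqrt (by linarith)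
  have hq0 : 0 ≤ q := Real.sqrt_nonneg _
  have hid : ∀ u, ((D.1 + u * w.1) ^ 2 + (D.2 + u * w.2) ^ 2) * N = (p + u * N) ^ 2 + c ^ 2 := by
    intro u; rw [hN, hc, hp]; ring
  refine ⟨(-q - p) / N, ⟨div_pos (by linarith) hN0, ?_⟩, ?_, ?_⟩
  · rw [div_le_iff₀ hN0]; linarith
  · have e : p + (-q - p) / N * N = -q := by rw [div_mul_cancel₀ _ hN0.ne']; ring
    have := hid ((-q - p) / N)
    rw [e] at this
    exact mul_right_cancel₀ hN0.ne' (by linarith)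
  · intro u hu
    rw [lt_div_iff₀ hN0] at hu
    have := hid u
    have h4 : q ^ 2 < (p + u * N) ^ 2 := by nlinarith
    exact lt_of_mul_lt_mul_right (by linarith) hN0.le

/-- The rotation by the angle `α`. -/
def rotate (α : ℝ) (p : ℝ × ℝ) : ℝ × ℝ :=
  (p.1 * Real.cos α - p.2 * Real.sin α, p.1 * Real.sin α + p.2 * Real.cos α)

theorem measurePreserving_rotate (α : ℝ) : MeasurePreserving (rotate α) volume volume := by
  set M : Matrix (Fin 2) (Fin 2) ℝ :=
    !![Real.cos α, -Real.sin α; Real.sin α, Real.cos α] with hM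
  have hdet : M.det = 1 := by
    rw [hM, Matrix.det_fin_two_of]
    have := Real.cos_sq_add_sin_sq α
    linarith
  have h1 := Real.map_matrix_volume_pi_eq_smul_volume_pi (M := M) (by rw [hdet]; exact one_ne_zero)
  rw [hdet] at h1
  simp only [inv_one, abs_one, ENNReal.ofReal_one, one_smul] at h1
  have h2 : MeasurePreserving (Matrix.toLin' M) volume volume :=
    ⟨(LinearMap.continuous_of_finiteDimensional _).measurable, h1⟩
  have h3 := ((volume_preserving_finTwoArrow ℝ).comp h2).comp
    (volume_preserving_finTwoArrow ℝ).symm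
  have e : rotate α = (MeasurableEquiv.finTwoArrow ∘ Matrix.toLin' M) ∘
      (MeasurableEquiv.finTwoArrow (α := ℝ)).symm := by
    funext p
    simp only [Function.comp, rotate, hM, MeasurableEquiv.finTwoArrow]
    ext
    · simp; ring
    · simp
  rw [e]
  exact h3

/-- The region swept by a disc of radius `R` has the area of a rectangle of width `2 R`. -/
theorem volume_sweep {R δ : ℝ} (hR : 0 < R) (hδ : 0 < δ) (w : ℝ × ℝ) :
    volume (sweep R δ w) = ENNReal.ofReal (2 * R * δ * √(w.1 ^ 2 + w.2 ^ 2)) := by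
  set ℓ := √(w.1 ^ 2 + w.2 ^ 2) with hℓ
  have hℓ0 : 0 ≤ ℓ := Real.sqrt_nonneg _
  have hℓℓ : ℓ ^ 2 = w.1 ^ 2 + w.2 ^ 2 := Real.sq_sqrt (by positivity)
  have hm : MeasurableSet (sweep R δ w) :=
    (measurableSet_sweep R δ).preimage (measurable_prodMk_right (y := w))
  rcases hℓ0.eq_or_lt with h0 | hpos
  · have : sweep R δ w = ∅ := by
      refine Set.eq_empty_of_forall_notMem fun D hD => ?_
      have h1 := hD.1
      rw [← hℓℓ, ← h0] at h1
      nlinarith [sq_nonneg (D.1 * w.2 - D.2 * w.1)]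
    rw [this, ← h0]
    simp
  obtain ⟨α, hα1, hα2⟩ : ∃ α, w.1 = ℓ * Real.cos α ∧ w.2 = ℓ * Real.sin α := by
    have h1 : w.1 / ℓ * (w.1 / ℓ) + w.2 / ℓ * (w.2 / ℓ) = 1 := by
      field_simp; linarith
    refine ⟨angle (w.1 / ℓ) (w.2 / ℓ), ?_, ?_⟩
    · rw [cos_angle h1]; field_simp
    · rw [sin_angle h1]; field_simp
  have hpre : rotate α ⁻¹' sweep R δ w = {p | p.2 ∈ Set.Ioo (-R) R ∧
      p.1 ∈ Set.Ico (-√(R ^ 2 - p.2 ^ 2) - δ * ℓ) (-√(R ^ 2 - p.2 ^ 2))} := by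
    ext p
    have hcs := Real.cos_sq_add_sin_sq α
    have e1 : (rotate α p).1 * w.2 - (rotate α p).2 * w.1 = -(ℓ * p.2) := by
      rw [hα1, hα2, rotate]; linear_combination -(ℓ * p.2) * hcs
    have e2 : (rotate α p).1 * w.1 + (rotate α p).2 * w.2 = ℓ * p.1 := by
      rw [hα1, hα2, rotate]; linear_combination (ℓ * p.1) * hcs
    have e3 : √(R ^ 2 * ℓ ^ 2 - (-(ℓ * p.2)) ^ 2) = ℓ * √(R ^ 2 - p.2 ^ 2) := by
      rw [show R ^ 2 * ℓ ^ 2 - (-(ℓ * p.2)) ^ 2 = ℓ ^ 2 * (R ^ 2 - p.2 ^ 2) by ring,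
        Real.sqrt_mul (by positivity), Real.sqrt_sq hℓ0]
    simp only [Set.mem_preimage, sweep, Set.mem_ofPred_eq, e1, e2, ← hℓℓ, e3]
    refine and_congr ?_ (and_congr ?_ ?_)
    · rw [Set.mem_Ioo, ← abs_lt, ← sq_lt_sq₀ (abs_nonneg _) hR.le, sq_abs,
        show (-(ℓ * p.2)) ^ 2 = p.2 ^ 2 * ℓ ^ 2 by ring]
      exact mul_lt_mul_iff_left₀ (by positivity)
    · rw [show -(ℓ * √(R ^ 2 - p.2 ^ 2)) - δ * ℓ ^ 2 = ℓ * (-√(R ^ 2 - p.2 ^ 2) - δ * ℓ) by ring]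
      exact mul_le_mul_iff_right₀ hpos
    · rw [show -(ℓ * √(R ^ 2 - p.2 ^ 2)) = ℓ * (-√(R ^ 2 - p.2 ^ 2)) by ring]
      exact mul_lt_mul_iff_right₀ hpos
  rw [← (measurePreserving_rotate α).measure_preimage hm.nullMeasurableSet,
    Measure.volume_eq_prod, Measure.prod_apply_symm ((measurePreserving_rotate α).measurable hm),
    hpre]
  have hslice : ∀ y : ℝ, volume ((fun x => (x, y)) ⁻¹' {p : ℝ × ℝ | p.2 ∈ Set.Ioo (-R) R ∧
      p.1 ∈ Set.Ico (-√(R ^ 2 - p.2 ^ 2) - δ * ℓ) (-√(R ^ 2 - p.2 ^ 2))}) =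
        (Set.Ioo (-R) R).indicator (fun _ => ENNReal.ofReal (δ * ℓ)) y := by
    intro y
    by_cases hy : y ∈ Set.Ioo (-R) R
    · rw [Set.indicator_of_mem hy]
      have : (fun x => (x, y)) ⁻¹' {p : ℝ × ℝ | p.2 ∈ Set.Ioo (-R) R ∧
          p.1 ∈ Set.Ico (-√(R ^ 2 - p.2 ^ 2) - δ * ℓ) (-√(R ^ 2 - p.2 ^ 2))} =
            Set.Ico (-√(R ^ 2 - y ^ 2) - δ * ℓ) (-√(R ^ 2 - y ^ 2)) := by
        ext x
        simp only [Set.mem_preimage, Set.mem_ofPred_eq, hy, true_and]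
      rw [this, Real.volume_Ico]
      congr 1
      ring
    · rw [Set.indicator_of_notMem hy, ← measure_empty (μ := (volume : Measure ℝ))]
      congr 1
      ext x
      simp only [Set.mem_preimage, Set.mem_ofPred_eq, hy, false_and, Set.mem_empty_iff_false]
  simp only [hslice]
  rw [lintegral_indicator measurableSet_Ioo, lintegral_const, Measure.restrict_apply_univ,
    Real.volume_Ioo, ← ENNReal.ofReal_mul (by positivity)]
  congr 1
  ring

/-! ### The mean relative speed -/

/-- The relative velocity of two nodes with direction angles `θ` and `φ`. -/
def relVelocity (v θ φ : ℝ) : ℝ × ℝ :=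
  (v * Real.cos θ - v * Real.cos φ, v * Real.sin θ - v * Real.sin φ)

theorem sqrt_relVelocity {v : ℝ} (hv : 0 < v) (θ φ : ℝ) :
    √((relVelocity v θ φ).1 ^ 2 + (relVelocity v θ φ).2 ^ 2) =
      2 * v * |Real.sin ((θ + -φ) / 2)| := by
  have h1 : Real.cos (θ + -φ) = Real.cos θ * Real.cos φ + Real.sin θ * Real.sin φ := by
    rw [← sub_eq_add_neg, Real.cos_sub]
  have h2 := Real.cos_sq_add_sin_sq θ
  have h3 := Real.cos_sq_add_sin_sq φ
  have h4 : Real.sin ((θ + -φ) / 2) ^ 2 = 1 / 2 - Real.cos (θ + -φ) / 2 := by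
    rw [Real.sin_sq_eq_half_sub]; ring_nf
  have : (relVelocity v θ φ).1 ^ 2 + (relVelocity v θ φ).2 ^ 2 =
      (2 * v * |Real.sin ((θ + -φ) / 2)|) ^ 2 := by
    rw [mul_pow, sq_abs, h4, h1]
    simp only [relVelocity]
    linear_combination v ^ 2 * h2 + v ^ 2 * h3
  rw [this, Real.sqrt_sq (by positivity)]

/-- Seen from any heading, the mean relative speed is `4 v / π`. -/
theorem lintegral_relVelocity {v : ℝ} (hv : 0 < v) (φ : ℝ) :
    ∫⁻ θ, ENNReal.ofReal (√((relVelocity v θ φ).1 ^ 2 + (relVelocity v θ φ).2 ^ 2))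
      ∂directionLaw = ENNReal.ofReal (4 * v / Real.pi) := by
  simp only [sqrt_relVelocity hv]
  have hper : Function.Periodic (fun x => ENNReal.ofReal (2 * v * |Real.sin (x / 2)|))
      (2 * Real.pi) := by
    intro x
    simp only
    rw [show (x + 2 * Real.pi) / 2 = x / 2 + Real.pi by ring, Real.sin_add_pi, abs_neg]
  have h1 := lintegral_Ioc_periodic_add Real.two_pi_pos hper 0 0 (-φ)
  rw [zero_add] at h1
  have h2 : ∫⁻ x in Set.Ioc 0 (2 * Real.pi), ENNReal.ofReal (2 * v * |Real.sin (x / 2)|) =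
      ENNReal.ofReal (8 * v) := by
    rw [← ofReal_integral_eq_lintegral_ofReal]
    · congr 1
      rw [← intervalIntegral.integral_of_le Real.two_pi_pos.le]
      have h3 : ∫ x in (0 : ℝ)..2 * Real.pi, 2 * v * |Real.sin (x / 2)| =
          ∫ x in (0 : ℝ)..2 * Real.pi, 2 * v * Real.sin (x / 2) := by
        refine intervalIntegral.integral_congr fun x hx => ?_
        rw [Set.uIcc_of_le Real.two_pi_pos.le] at hx
        rw [abs_of_nonneg (Real.sin_nonneg_of_nonneg_of_le_pi (by linarith [hx.1])
          (by linarith [hx.2]))]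
      rw [h3, intervalIntegral.integral_const_mul,
        intervalIntegral.integral_comp_div (fun x => Real.sin x) two_ne_zero]
      rw [integral_sin, zero_div, mul_div_cancel_left₀ _ two_ne_zero, Real.cos_zero, Real.cos_pi,
        smul_eq_mul]
      ring
    · exact (Continuous.integrableOn_Ioc (by fun_prop))
    · exact Filter.Eventually.of_forall fun x => by positivity
  rw [lintegral_directionLaw, h1, h2, mul_comm, ← div_eq_mul_inv,
    ← ENNReal.ofReal_div_of_pos Real.two_pi_pos]
  congr 1
  field_simp
  ring

/-! ### A lower bound for the number of meetings -/

theorem count_eq_zero {g : ℕ → ℝ} {c : ℝ} (h : c < g 0) : count g c = 0 :=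
  Nat.sInf_eq_zero.2 (Or.inl (by simpa using h))

/-- Before the first direction change the motion is uniform. -/
theorem displ_of_lt_gap {F : ℝ → ℝ} (hFm : Measurable F) (hF : ∀ x, |F x| ≤ 1) (v : ℝ) {τ δ : ℝ}
    (hτ : 0 ≤ τ) {y : (ℕ → ℝ) × (ℕ → ℝ)} (hy : τ * δ < y.2 0) {s : ℝ} (hs : s ∈ Set.Icc 0 δ) :
    displ F v τ y s = s * (v * F (y.1 0)) := by
  have h := displ_sub_of_count_eq hFm hF v τ y (k := 0) hs.1 fun u hu =>
    count_eq_zero ((mul_le_mul_of_nonneg_left (hu.2.trans hs.2) hτ).trans_lt hy)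
  have h0 : displ F v τ y 0 = 0 := intervalIntegral.integral_same
  rw [h0, sub_zero, sub_zero] at h
  exact h

/-- A pair of nodes that do not change direction up to time `δ`, stay away from the border, and
meet by uniform relative motion. The second node starts at distance at least `R + 3 v δ` from the
border: then the first one, which is within `R + 2 v δ` of it, is not reflected before time `δ`. -/
def enterEvent (L v τ R δ : ℝ) : Set (NodeSample × NodeSample) :=
  {q | τ * δ < q.1.2.2 0 ∧ (q.1.1 0 - q.2.1 0, q.1.1 1 - q.2.1 1) ∈
      sweep R δ (relVelocity v (q.1.2.1 0) (q.2.2.1 0))} ∩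
    {q | (∀ i, q.2.1 i ∈ Set.Icc (R + 3 * v * δ) (L - (R + 3 * v * δ))) ∧ τ * δ < q.2.2.2 0}

theorem measurableSet_enterEvent (L v τ R δ : ℝ) : MeasurableSet (enterEvent L v τ R δ) := by
  have h1 : Measurable fun q : NodeSample × NodeSample =>
      ((q.1.1 0 - q.2.1 0, q.1.1 1 - q.2.1 1), relVelocity v (q.1.2.1 0) (q.2.2.1 0)) := by
    unfold relVelocity
    fun_prop
  have h2 : MeasurableSet {q : NodeSample × NodeSample |
      ∀ i, q.2.1 i ∈ Set.Icc (R + 3 * v * δ) (L - (R + 3 * v * δ))} :=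
    (measurableSet_coordinates measurableSet_Icc).preimage (measurable_fst.comp measurable_snd)
  have h3 : Measurable fun q : NodeSample × NodeSample => q.1.2.2 0 := by fun_prop
  have h4 : Measurable fun q : NodeSample × NodeSample => q.2.2.2 0 := by fun_prop
  exact ((measurableSet_lt measurable_const h3).inter
    ((measurableSet_sweep R δ).preimage h1)).inter (h2.inter (measurableSet_lt measurable_const h4))

/-- The relative speed is at most `2 v`, so a disc that is entered within time `δ` is close. -/
theorem abs_le_of_mem_sweep {v R δ θ φ : ℝ} (hv : 0 < v) (hR : 0 < R) {D : ℝ × ℝ}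
    (hD : D ∈ sweep R δ (relVelocity v θ φ)) :
    |D.1| ≤ R + 2 * v * δ ∧ |D.2| ≤ R + 2 * v * δ := by
  obtain ⟨s, hs, h1, -⟩ := exists_entrance hD
  have hw1 : |(relVelocity v θ φ).1| ≤ 2 * v := by
    have h1 := abs_le.1 (Real.abs_cos_le_one θ)
    have h2 := abs_le.1 (Real.abs_cos_le_one φ)
    simp only [relVelocity]
    rw [abs_le]; constructor <;> nlinarith
  have hw2 : |(relVelocity v θ φ).2| ≤ 2 * v := by
    have h1 := abs_le.1 (Real.abs_sin_le_one θ)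
    have h2 := abs_le.1 (Real.abs_sin_le_one φ)
    simp only [relVelocity]
    rw [abs_le]; constructor <;> nlinarith
  have key : ∀ {x w : ℝ}, |w| ≤ 2 * v → (x + s * w) ^ 2 ≤ R ^ 2 → |x| ≤ R + 2 * v * δ := by
    intro x w hw hx
    have h2 : |x + s * w| ≤ R := abs_le_of_sq_le_sq hx hR.le
    have h3 : |s * w| ≤ 2 * v * δ := by
      rw [abs_mul, abs_of_pos hs.1]
      nlinarith [hs.1, hs.2, abs_nonneg w]
    have h4 : |x| ≤ |x + s * w| + |s * w| := by
      simpa using abs_sub (x + s * w) (s * w)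
    linarith
  exact ⟨key hw1 (by nlinarith [sq_nonneg (D.2 + s * (relVelocity v θ φ).2)]),
    key hw2 (by nlinarith [sq_nonneg (D.1 + s * (relVelocity v θ φ).1)])⟩

theorem nonempty_meetings_of_mem_enterEvent {L v τ R δ : ℝ} (hL : 0 < L) (hv : 0 < v)
    (hτ : 0 ≤ τ) (hR : 0 < R) {q : NodeSample × NodeSample} (hq : q ∈ enterEvent L v τ R δ) :
    (meetings R (path L v τ q.1) (path L v τ q.2) (Set.Ioc 0 δ) Set.univ).Nonempty := by
  obtain ⟨⟨hg, hD⟩, hx, hg'⟩ := hq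
  obtain ⟨s, hs, hs1, hs2⟩ := exists_entrance hD
  have hδ : 0 < δ := hs.1.trans_le hs.2
  have hb := abs_le_of_mem_sweep hv hR hD
  have hb1 := abs_le.1 hb.1
  have hb2 := abs_le.1 hb.2
  have hx0 := hx 0
  have hx1 := hx 1
  simp only [Set.mem_Icc] at hx0 hx1
  simp only at hb1 hb2
  have hfold : ∀ {x c r : ℝ}, x ∈ Set.Icc (v * δ) (L - v * δ) → |c| ≤ 1 → r ∈ Set.Icc 0 δ →
      fold L (x + r * (v * c)) = x + r * (v * c) := by
    intro x c r hx hc hr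
    have h1 : |r * (v * c)| ≤ v * δ := by
      rw [abs_mul, abs_mul, abs_of_nonneg hr.1, abs_of_pos hv]
      have h2 : v * |c| ≤ v := mul_le_of_le_one_right hv.le hc
      have h3 : 0 ≤ v * |c| := by positivity
      nlinarith [hr.1, hr.2]
    have h4 := abs_le.1 h1
    exact fold_of_mem hL ⟨by linarith [hx.1], by linarith [hx.2]⟩
  have hvδ : 0 < v * δ := mul_pos hv hδ
  have hp1 : ∀ r ∈ Set.Icc 0 δ, path L v τ q.1 r =
      !₂[q.1.1 0 + r * (v * Real.cos (q.1.2.1 0)), q.1.1 1 + r * (v * Real.sin (q.1.2.1 0))] := by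
    intro r hr
    rw [path_eq, displ_of_lt_gap Real.measurable_cos Real.abs_cos_le_one v hτ hg hr,
      displ_of_lt_gap Real.measurable_sin Real.abs_sin_le_one v hτ hg hr,
      hfold ⟨by linarith, by linarith⟩ (Real.abs_cos_le_one _) hr,
      hfold ⟨by linarith, by linarith⟩ (Real.abs_sin_le_one _) hr]
  have hp2 : ∀ r ∈ Set.Icc 0 δ, path L v τ q.2 r =
      !₂[q.2.1 0 + r * (v * Real.cos (q.2.2.1 0)), q.2.1 1 + r * (v * Real.sin (q.2.2.1 0))] := by
    intro r hr
    rw [path_eq, displ_of_lt_gap Real.measurable_cos Real.abs_cos_le_one v hτ hg' hr,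
      displ_of_lt_gap Real.measurable_sin Real.abs_sin_le_one v hτ hg' hr,
      hfold ⟨by linarith, by linarith⟩ (Real.abs_cos_le_one _) hr,
      hfold ⟨by linarith, by linarith⟩ (Real.abs_sin_le_one _) hr]
  have hdist : ∀ r ∈ Set.Icc 0 δ, dist (path L v τ q.1 r) (path L v τ q.2 r) =
      √((q.1.1 0 - q.2.1 0 + r * (relVelocity v (q.1.2.1 0) (q.2.2.1 0)).1) ^ 2 +
        (q.1.1 1 - q.2.1 1 + r * (relVelocity v (q.1.2.1 0) (q.2.2.1 0)).2) ^ 2) := by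
    intro r hr
    rw [hp1 r hr, hp2 r hr, EuclideanSpace.dist_eq, Fin.sum_univ_two, Real.dist_eq, Real.dist_eq,
      sq_abs, sq_abs]
    simp only [relVelocity, Matrix.cons_val_zero, Matrix.cons_val_one, Matrix.cons_val_fin_one]
    ring_nf
  refine ⟨s, hs, ⟨?_, ?_⟩, Set.mem_univ _⟩
  · rw [hdist s ⟨hs.1.le, hs.2⟩, hs1, Real.sqrt_sq hR.le]
  · refine (nhdsLT_basis s).eventually_iff.2 ⟨0, hs.1, fun u hu => ?_⟩
    rw [hdist u ⟨hu.1.le, hu.2.le.trans hs.2⟩, Real.lt_sqrt hR.le]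
    exact hs2 u hu.2

theorem iidLaw_gap_zero {c : ℝ} (hc : 0 ≤ c) :
    iidLaw gapLaw {g | c < g 0} = ENNReal.ofReal (Real.exp (-c)) := by
  rw [← gapLaw_Ioi hc]
  exact (measurePreserving_eval_infinitePi (fun _ : ℕ => gapLaw) 0).measure_preimage
    measurableSet_Ioi.nullMeasurableSet

/-- The probability that a node enters the disc around a second node, given the sample of the
latter. -/
theorem nodeLaw_enter {L v τ R δ : ℝ} (hv : 0 < v)
    (hτ : 0 ≤ τ) (hR : 0 < R) (hδ : 0 < δ) {ω' : NodeSample}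
    (hω' : ∀ i, ω'.1 i ∈ Set.Icc (R + 3 * v * δ) (L - (R + 3 * v * δ))) :
    nodeLaw L {ω | τ * δ < ω.2.2 0 ∧ (ω.1 0 - ω'.1 0, ω.1 1 - ω'.1 1) ∈
      sweep R δ (relVelocity v (ω.2.1 0) (ω'.2.1 0))} =
      (volume (square L))⁻¹ * (ENNReal.ofReal (2 * R * δ) * ENNReal.ofReal (4 * v / Real.pi) *
        ENNReal.ofReal (Real.exp (-(τ * δ)))) := by
  have hm : MeasurableSet {ω : NodeSample | τ * δ < ω.2.2 0 ∧ (ω.1 0 - ω'.1 0, ω.1 1 - ω'.1 1) ∈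
      sweep R δ (relVelocity v (ω.2.1 0) (ω'.2.1 0))} := by
    have h1 : Measurable fun ω : NodeSample =>
        ((ω.1 0 - ω'.1 0, ω.1 1 - ω'.1 1), relVelocity v (ω.2.1 0) (ω'.2.1 0)) := by
      unfold relVelocity
      fun_prop
    have h2 : Measurable fun ω : NodeSample => ω.2.2 0 := by fun_prop
    exact (measurableSet_lt measurable_const h2).inter ((measurableSet_sweep R δ).preimage h1)
  have hslice : ∀ θ, (volume[|square L] : Measure Plane) {x | (x 0 - ω'.1 0, x 1 - ω'.1 1) ∈
      sweep R δ (relVelocity v θ (ω'.2.1 0))} = (volume (square L))⁻¹ * (ENNReal.ofReal (2 * R * δ) *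
        ENNReal.ofReal (√((relVelocity v θ (ω'.2.1 0)).1 ^ 2 +
          (relVelocity v θ (ω'.2.1 0)).2 ^ 2))) := by
    intro θ
    have hms : MeasurableSet (sweep R δ (relVelocity v θ (ω'.2.1 0))) :=
      (measurableSet_sweep R δ).preimage (measurable_prodMk_right (y := relVelocity v θ (ω'.2.1 0)))
    have hmA : MeasurableSet {x : Plane | (x 0 - ω'.1 0, x 1 - ω'.1 1) ∈
        sweep R δ (relVelocity v θ (ω'.2.1 0))} := hms.preimage (by fun_prop)
    have hsub : {x : Plane | (x 0 - ω'.1 0, x 1 - ω'.1 1) ∈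
        sweep R δ (relVelocity v θ (ω'.2.1 0))} ⊆ square L := by
      intro x hx
      have hb := abs_le_of_mem_sweep hv hR hx
      have hb1 := abs_le.1 hb.1
      have hb2 := abs_le.1 hb.2
      have hx0 := hω' 0
      have hx1 := hω' 1
      simp only [Set.mem_Icc] at hx0 hx1 hb1 hb2
      have hvδ : 0 < v * δ := mul_pos hv hδ
      rw [square, Set.mem_ofPred_eq, Fin.forall_fin_two]
      exact ⟨⟨by linarith, by linarith⟩, ⟨by linarith, by linarith⟩⟩
    have hpre : planeEquiv ⁻¹' {x : Plane | (x 0 - ω'.1 0, x 1 - ω'.1 1) ∈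
        sweep R δ (relVelocity v θ (ω'.2.1 0))} = (fun p : ℝ × ℝ => p - (ω'.1 0, ω'.1 1)) ⁻¹'
          sweep R δ (relVelocity v θ (ω'.2.1 0)) := rfl
    rw [cond_apply (measurableSet_square L), Set.inter_eq_right.2 hsub,
      ← measurePreserving_planeEquiv.measure_preimage hmA.nullMeasurableSet, hpre,
      (measurePreserving_sub_right volume _).measure_preimage hms.nullMeasurableSet,
      volume_sweep hR hδ, ENNReal.ofReal_mul (by positivity)]
  have hmg : Measurable fun θ => ENNReal.ofReal (√((relVelocity v θ (ω'.2.1 0)).1 ^ 2 +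
      (relVelocity v θ (ω'.2.1 0)).2 ^ 2)) := by
    unfold relVelocity
    fun_prop
  have hint : ∀ y : (ℕ → ℝ) × (ℕ → ℝ), (volume[|square L] : Measure Plane)
      ((fun x => (x, y)) ⁻¹' {ω : NodeSample | τ * δ < ω.2.2 0 ∧
        (ω.1 0 - ω'.1 0, ω.1 1 - ω'.1 1) ∈
          sweep R δ (relVelocity v (ω.2.1 0) (ω'.2.1 0))}) =
      (fun θ : ℕ → ℝ => (volume (square L))⁻¹ * (ENNReal.ofReal (2 * R * δ) *
        ENNReal.ofReal (√((relVelocity v (θ 0) (ω'.2.1 0)).1 ^ 2 +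
          (relVelocity v (θ 0) (ω'.2.1 0)).2 ^ 2)))) y.1 *
        ({g : ℕ → ℝ | τ * δ < g 0}.indicator 1) y.2 := by
    intro y
    by_cases hy : τ * δ < y.2 0
    · rw [Set.indicator_of_mem (show y.2 ∈ {g : ℕ → ℝ | τ * δ < g 0} from hy), Pi.one_apply,
        mul_one]
      refine Eq.trans ?_ (hslice (y.1 0))
      congr 1
      ext x
      simp only [Set.mem_preimage, Set.mem_ofPred_eq, hy, true_and]
    · rw [Set.indicator_of_notMem (show y.2 ∉ {g : ℕ → ℝ | τ * δ < g 0} from hy), mul_zero,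
        ← measure_empty (μ := (volume[|square L] : Measure Plane))]
      congr 1
      ext x
      simp only [Set.mem_preimage, Set.mem_ofPred_eq, hy, false_and, Set.mem_empty_iff_false]
  have hmset : MeasurableSet {g : ℕ → ℝ | τ * δ < g 0} :=
    measurableSet_lt measurable_const (by fun_prop)
  have heval : Measurable fun θ : ℕ → ℝ => θ 0 := measurable_pi_apply 0
  have hmf : Measurable fun θ : ℕ → ℝ => ENNReal.ofReal (√((relVelocity v (θ 0) (ω'.2.1 0)).1 ^ 2 +
      (relVelocity v (θ 0) (ω'.2.1 0)).2 ^ 2)) := hmg.comp heval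
  rw [nodeLaw, Measure.prod_apply_symm hm]
  simp only [hint]
  have hmean := (measurePreserving_eval_infinitePi (fun _ : ℕ => directionLaw) 0).lintegral_comp hmg
  rw [lintegral_relVelocity hv] at hmean
  simp only [Function.eval] at hmean
  rw [lintegral_prod_mul (((hmf.const_mul _).const_mul _).aemeasurable)
    (measurable_one.indicator hmset).aemeasurable, lintegral_indicator_one hmset,
    iidLaw_gap_zero (by positivity), lintegral_const_mul _ (hmf.const_mul _),
    lintegral_const_mul _ hmf, hmean, mul_assoc]

theorem volume_inner_square (L m : ℝ) (hm : 0 ≤ m) :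
    (volume[|square L] : Measure Plane) {x | ∀ i, x i ∈ Set.Icc m (L - m)} =
      (volume (square L))⁻¹ * ENNReal.ofReal (L - 2 * m) ^ 2 := by
  have hsub : {x : Plane | ∀ i, x i ∈ Set.Icc m (L - m)} ⊆ square L := fun x hx i =>
    ⟨hm.trans (hx i).1, (hx i).2.trans (by linarith)⟩
  have hms : MeasurableSet {x : Plane | ∀ i, x i ∈ Set.Icc m (L - m)} :=
    measurableSet_coordinates measurableSet_Icc
  have hpre : planeEquiv ⁻¹' {x : Plane | ∀ i, x i ∈ Set.Icc m (L - m)} =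
      Set.Icc m (L - m) ×ˢ Set.Icc m (L - m) := by
    ext p
    simp only [Set.mem_preimage, planeEquiv_apply, Set.mem_ofPred_eq, Fin.forall_fin_two,
      Set.mem_prod]
    rfl
  rw [cond_apply (measurableSet_square L), Set.inter_eq_right.2 hsub,
    ← measurePreserving_planeEquiv.measure_preimage hms.nullMeasurableSet, hpre,
    Measure.volume_eq_prod, Measure.prod_prod, Real.volume_Icc, ← sq,
    show L - m - m = L - 2 * m by ring]

theorem prod_enterEvent {L v τ R δ : ℝ} (hL : 0 < L) (hv : 0 < v)
    (hτ : 0 ≤ τ) (hR : 0 < R) (hδ : 0 < δ) :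
    (nodeLaw L).prod (nodeLaw L) (enterEvent L v τ R δ) =
      (volume (square L))⁻¹ * (ENNReal.ofReal (2 * R * δ) * ENNReal.ofReal (4 * v / Real.pi) *
        ENNReal.ofReal (Real.exp (-(τ * δ)))) * ((volume (square L))⁻¹ *
          ENNReal.ofReal (L - 2 * (R + 3 * v * δ)) ^ 2 * ENNReal.ofReal (Real.exp (-(τ * δ)))) := by
  have := isProbabilityMeasure_nodeLaw hL
  set G : Set NodeSample := {ω' | (∀ i, ω'.1 i ∈ Set.Icc (R + 3 * v * δ) (L - (R + 3 * v * δ))) ∧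
    τ * δ < ω'.2.2 0} with hG
  have hGprod : G = {x : Plane | ∀ i, x i ∈ Set.Icc (R + 3 * v * δ) (L - (R + 3 * v * δ))} ×ˢ
      (Set.univ ×ˢ {g : ℕ → ℝ | τ * δ < g 0}) := by
    ext ω
    simp [hG]
  have hGm : MeasurableSet G := by
    rw [hGprod]
    exact (measurableSet_coordinates measurableSet_Icc).prod (MeasurableSet.univ.prod
      (measurableSet_lt measurable_const (measurable_pi_apply 0)))
  have hGlaw : nodeLaw L G = (volume (square L))⁻¹ *
      ENNReal.ofReal (L - 2 * (R + 3 * v * δ)) ^ 2 * ENNReal.ofReal (Real.exp (-(τ * δ))) := by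
    rw [hGprod, nodeLaw, Measure.prod_prod, Measure.prod_prod, measure_univ, one_mul,
      volume_inner_square L _ (by positivity), iidLaw_gap_zero (by positivity)]
  rw [Measure.prod_apply_symm (measurableSet_enterEvent L v τ R δ)]
  have hslice : ∀ ω', nodeLaw L ((fun ω => (ω, ω')) ⁻¹' enterEvent L v τ R δ) =
      G.indicator (fun _ => (volume (square L))⁻¹ * (ENNReal.ofReal (2 * R * δ) *
        ENNReal.ofReal (4 * v / Real.pi) * ENNReal.ofReal (Real.exp (-(τ * δ))))) ω' := by
    intro ω'
    by_cases hω' : ω' ∈ G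
    · rw [Set.indicator_of_mem hω', ← nodeLaw_enter hv hτ hR hδ hω'.1]
      congr 1
      ext ω
      exact ⟨fun h => h.1, fun h => ⟨h, hω'⟩⟩
    · rw [Set.indicator_of_notMem hω', ← measure_empty (μ := nodeLaw L)]
      congr 1
      ext ω
      exact ⟨fun h => hω' h.2, fun h => h.elim⟩
  simp only [hslice]
  rw [lintegral_indicator hGm, lintegral_const, Measure.restrict_apply_univ, hGlaw]

/-- Superadditivity of the lower integral; the functions need not be measurable. -/
theorem sum_lintegral_le {α ι : Type*} {m : MeasurableSpace α} (μ : Measure α) (s : Finset ι)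
    (f : ι → α → ℝ≥0∞) : ∑ i ∈ s, ∫⁻ a, f i a ∂μ ≤ ∫⁻ a, ∑ i ∈ s, f i a ∂μ := by
  classical
  induction s using Finset.induction_on with
  | empty => exact bot_le
  | insert i s hi ih =>
    simp only [Finset.sum_insert hi]
    refine le_trans ?_ (le_lintegral_add _ _)
    gcongr

theorem pairCount_mul_le_expectedMeetings (n : ℕ) {L v τ R δ : ℝ} (hL : 0 < L) (hv : 0 < v)
    (hτ : 0 ≤ τ) (hR : 0 < R) :
    pairCount n * (nodeLaw L).prod (nodeLaw L) (enterEvent L v τ R δ) ≤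
      expectedMeetings n L v τ R δ Set.univ := by
  rw [expectedMeetings_eq, pairCount, Finset.sum_mul]
  unfold totalMeetings
  refine le_trans (Finset.sum_le_sum fun i _ => ?_) (sum_lintegral_le _ _ _)
  rw [Finset.sum_mul]
  refine le_trans (Finset.sum_le_sum fun j hj => ?_) (sum_lintegral_le _ _ _)
  have hpair := measurePreserving_pair n hL (Finset.mem_Ioi.1 hj).ne
  have hm := measurableSet_enterEvent L v τ R δ
  rw [one_mul, ← hpair.measure_preimage hm.nullMeasurableSet,
    ← lintegral_indicator_one (hpair.measurable hm)]
  refine lintegral_mono fun ω => ?_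
  by_cases hω : ω ∈ (fun ω : Fin n → NodeSample => (ω i, ω j)) ⁻¹' enterEvent L v τ R δ
  · rw [Set.indicator_of_mem hω]
    have h1 := nonempty_meetings_of_mem_enterEvent hL hv hτ hR hω
    have h2 := ENat.toENNReal_le.2 (Set.one_le_encard_iff_nonempty.2 h1)
    simpa using h2
  · rw [Set.indicator_of_notMem hω]
    exact bot_le

/-- The expected number of meetings, bounded below by the area swept by the discs around the nodes
that stay away from the border. -/
theorem le_expectedMeetings_univ (n : ℕ) {L v τ R h : ℝ} (hL : 0 < L) (hv : 0 < v)
    (hτ : 0 ≤ τ) (hR : 0 < R) (hh : 0 < h) :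
    pairCount n * ((volume (square L))⁻¹ ^ 2 *
      ENNReal.ofReal (2 * R * h * (4 * v / Real.pi) * (max (L - 2 * R) 0) ^ 2)) ≤
      expectedMeetings n L v τ R h Set.univ := by
  -- The window is cut into `m + 1` parts; as their length tends to `0`, so do the probability of a
  -- direction change and the part of the margin that depends on the speed.
  have hle : ∀ m : ℕ, pairCount n * ((volume (square L))⁻¹ ^ 2 *
      ENNReal.ofReal (2 * R * h * (4 * v / Real.pi) *
        (max (L - 2 * (R + 3 * v * (h / (m + 1 : ℕ)))) 0) ^ 2 *
          (Real.exp (-(τ * (h / (m + 1 : ℕ))))) ^ 2)) ≤ expectedMeetings n L v τ R h Set.univ := by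
    intro m
    have hδ : 0 < h / (m + 1 : ℕ) := by positivity
    have h1 := mul_expectedMeetings_le n hL v hτ hδ.le R Set.univ (m + 1)
    rw [mul_div_cancel₀ h (by positivity : ((m + 1 : ℕ) : ℝ) ≠ 0)] at h1
    refine le_trans (le_of_eq ?_) ((mul_le_mul_right
      (pairCount_mul_le_expectedMeetings n hL hv hτ hR) _).trans h1)
    set δ := h / (m + 1 : ℕ) with hδdef
    have hmax : ENNReal.ofReal (L - 2 * (R + 3 * v * δ)) =
        ENNReal.ofReal (max (L - 2 * (R + 3 * v * δ)) 0) := by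
      rw [ENNReal.ofReal_max, ENNReal.ofReal_zero, max_eq_left zero_le]
    have hh' : h = (m + 1 : ℕ) * δ := (mul_div_cancel₀ h (by positivity)).symm
    rw [prod_enterEvent hL hv hτ hR hδ, hmax]
    set a := max (L - 2 * (R + 3 * v * δ)) 0 with ha
    have ha0 : 0 ≤ a := le_max_right _ _
    have hring : ∀ M Q V A B C E : ℝ≥0∞, M * (Q * (V * (A * B * E) * (V * C ^ 2 * E))) =
        Q * (V ^ 2 * (M * A * B * C ^ 2 * E ^ 2)) := by
      intros; ring
    rw [hring, ← ENNReal.ofReal_natCast, ← ENNReal.ofReal_pow ha0,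
      ← ENNReal.ofReal_pow (Real.exp_nonneg _), ← ENNReal.ofReal_mul (by positivity),
      ← ENNReal.ofReal_mul (by positivity), ← ENNReal.ofReal_mul (by positivity),
      ← ENNReal.ofReal_mul (by positivity)]
    congr 3
    rw [hh']
    ring
  set f : ℝ → ℝ := fun δ => 2 * R * h * (4 * v / Real.pi) *
    (max (L - 2 * (R + 3 * v * δ)) 0) ^ 2 * (Real.exp (-(τ * δ))) ^ 2 with hf
  have hfc : Continuous f := by fun_prop
  have hδ : Filter.Tendsto (fun m : ℕ => h / (m + 1 : ℕ)) Filter.atTop (𝓝 0) :=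
    (Filter.tendsto_add_atTop_iff_nat 1).2 (tendsto_const_div_atTop_nhds_zero_nat h)
  have hV : (volume (square L))⁻¹ ^ 2 ≠ ⊤ :=
    ENNReal.pow_ne_top (ENNReal.inv_ne_top.2 (volume_square_ne_zero hL))
  have hlim : Filter.Tendsto (fun m : ℕ => pairCount n * ((volume (square L))⁻¹ ^ 2 *
      ENNReal.ofReal (f (h / (m + 1 : ℕ))))) Filter.atTop
        (𝓝 (pairCount n * ((volume (square L))⁻¹ ^ 2 * ENNReal.ofReal (f 0)))) :=
    ENNReal.Tendsto.const_mul (ENNReal.Tendsto.const_mul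
      (ENNReal.tendsto_ofReal ((hfc.tendsto 0).comp hδ)) (Or.inr hV)) (Or.inr (pairCount_ne_top n))
  have hf0 : f 0 = 2 * R * h * (4 * v / Real.pi) * (max (L - 2 * R) 0) ^ 2 := by
    simp [hf]
  rw [← hf0]
  exact le_of_tendsto' hlim hle

/-! ### The tail of the meeting duration -/

theorem expectedMeetings_mono (n : ℕ) (L v τ R h : ℝ) {D D' : Set ℝ≥0∞} (hD : D ⊆ D') :
    expectedMeetings n L v τ R h D ≤ expectedMeetings n L v τ R h D' := by
  rw [expectedMeetings_eq, expectedMeetings_eq]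
  refine lintegral_mono fun ω => Finset.sum_le_sum fun i _ => Finset.sum_le_sum fun j _ => ?_
  exact ENat.toENNReal_le.2 (Set.encard_le_encard fun s hs => ⟨hs.1, hs.2.1, hD hs.2.2⟩)

theorem pairCount_ne_zero {n : ℕ} (hn : 2 ≤ n) : pairCount n ≠ 0 := by
  intro h
  have h1 := (Finset.sum_eq_zero_iff.1 h) ⟨0, by omega⟩ (Finset.mem_univ _)
  have h2 := (Finset.sum_eq_zero_iff.1 h1) ⟨1, by omega⟩
    (Finset.mem_Ioi.2 (Fin.mk_lt_mk.2 zero_lt_one))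
  exact one_ne_zero h2

theorem sq_le_of_large {R ε L : ℝ} (hR : 0 < R) (hε : 0 < ε) (hL : 4 * R + 8 * R / ε ≤ L) :
    L ^ 2 ≤ (1 + ε) * (L - 2 * R) ^ 2 := by
  have h1 : 8 * R ≤ ε * (L - 2 * R) := by
    have : 8 * R / ε ≤ L - 2 * R := by linarith
    rw [div_le_iff₀ hε] at this
    linarith
  have h2 : 0 < 8 * R / ε := by positivity
  have h3 : 2 * R ≤ L - 2 * R := by linarith
  nlinarith [mul_le_mul_of_nonneg_right h1 (show 0 ≤ L - 2 * R by linarith)]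

/-- The quotient of the two bounds exceeds `π² R / (8 v t)` by the factor `L² / (L - 2 R)²`, which is
at most `1 + ε`. If `π² R / (8 v t) ≥ 1`, the trivial bound `1` is used. -/
theorem meetingProb_Ici_le (n : ℕ) {L v τ R ε h t : ℝ} (hv : 0 < v) (hR : 0 < R)
    (hε : 0 < ε) (hτ : 0 ≤ τ) (hh : 0 < h) (ht : 0 < t) (hL : 4 * R + 8 * R / ε ≤ L) :
    meetingProb n L v τ R h (Set.Ici (ENNReal.ofReal t)) ≤
      ENNReal.ofReal (min 1 (Real.pi ^ 2 * R / (8 * v * t)) + ε) := by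
  have h0 : 0 < 8 * R / ε := by positivity
  have hL2 : 2 * R < L := by linarith
  have hLpos : 0 < L := by linarith
  refine ENNReal.div_le_of_le_mul ?_
  rcases le_total 1 (Real.pi ^ 2 * R / (8 * v * t)) with hx | hx
  · rw [min_eq_left hx]
    refine (expectedMeetings_mono n L v τ R h (Set.subset_univ _)).trans ?_
    refine le_mul_of_one_le_left zero_le ?_
    rw [ENNReal.one_le_ofReal]
    linarith
  · rw [min_eq_right hx]
    refine (expectedMeetings_Ici_le n hLpos v hτ hh ht R).trans (le_trans ?_
      (mul_le_mul_right (le_expectedMeetings_univ n hLpos hv hτ hR hh) _))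
    have hV : volume (square L) = ENNReal.ofReal (L ^ 2) := by
      rw [volume_square, ← ENNReal.ofReal_mul hLpos.le, sq]
    rw [mul_left_comm, mul_assoc, hV, max_eq_left (by linarith : 0 ≤ L - 2 * R),
      ← ENNReal.ofReal_inv_of_pos (by positivity), ← ENNReal.ofReal_pow hR.le,
      ← ENNReal.ofReal_pow (show 0 ≤ (L ^ 2)⁻¹ by positivity), ← ENNReal.ofReal_mul (by positivity),
      ← ENNReal.ofReal_div_of_pos (by positivity), ← ENNReal.ofReal_mul (by positivity),
      ← ENNReal.ofReal_mul (by positivity), ← ENNReal.ofReal_mul (by positivity)]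
    refine mul_le_mul_right (ENNReal.ofReal_le_ofReal ?_) _
    set x := Real.pi ^ 2 * R / (8 * v * t) with hxdef
    have hx0 : 0 < x := by positivity
    have hsq := sq_le_of_large hR hε hL
    have hu : 0 < (L - 2 * R) ^ 2 := by
      have : 0 < L - 2 * R := by linarith
      positivity
    have e1 : R ^ 2 * Real.pi / L ^ 2 * (h / t) =
        (x * L ^ 2) * ((L ^ 2)⁻¹ ^ 2 * (2 * R * h * (4 * v / Real.pi))) := by
      rw [hxdef]
      field_simp
      ring
    have e2 : (x + ε) * ((L ^ 2)⁻¹ ^ 2 * (2 * R * h * (4 * v / Real.pi) * (L - 2 * R) ^ 2)) =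
        ((x + ε) * (L - 2 * R) ^ 2) * ((L ^ 2)⁻¹ ^ 2 * (2 * R * h * (4 * v / Real.pi))) := by
      ring
    rw [e1, e2]
    refine mul_le_mul_of_nonneg_right ?_ (by positivity)
    have h3 : x * (1 + ε) ≤ x + ε := by nlinarith
    calc x * L ^ 2 ≤ x * ((1 + ε) * (L - 2 * R) ^ 2) := mul_le_mul_of_nonneg_left hsq hx0.le
      _ = (x * (1 + ε)) * (L - 2 * R) ^ 2 := by ring
      _ ≤ _ := mul_le_mul_of_nonneg_right h3 hu.le

theorem expectedMeetings_univ_ne_zero {n : ℕ} (hn : 2 ≤ n) {L v τ R h : ℝ} (hv : 0 < v)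
    (hR : 0 < R) (hτ : 0 ≤ τ) (hh : 0 < h) (hL : 2 * R < L) :
    expectedMeetings n L v τ R h Set.univ ≠ 0 := by
  have hLpos : 0 < L := by linarith
  have hu : 0 < L - 2 * R := by linarith
  refine ne_of_gt (lt_of_lt_of_le ?_ (le_expectedMeetings_univ n hLpos hv hτ hR hh))
  refine ENNReal.mul_pos (pairCount_ne_zero hn) (mul_ne_zero (pow_ne_zero _
    (ENNReal.inv_ne_zero.2 (volume_square_ne_top L))) ?_)
  rw [max_eq_left hu.le]
  exact (ENNReal.ofReal_pos.2 (by positivity)).ne'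

end

end MobileNetwork

theorem lemma2 (v R ε : ℝ) (hv : 0 < v) (hR : 0 < R) (hε : 0 < ε) :
    ∃ L₀ : ℝ, 0 < L₀ ∧ ∀ (L : ℝ), L₀ ≤ L → ∀ (n : ℕ), 2 ≤ n → ∀ (τ : ℝ), 0 ≤ τ →
      ∀ (h : ℝ), 0 < h →
        MobileNetwork.expectedMeetings n L v τ R h Set.univ ≠ 0 ∧
        MobileNetwork.expectedMeetings n L v τ R h Set.univ ≠ ⊤ ∧
        ∀ (t : ℝ), 0 < t →
          MobileNetwork.meetingProb n L v τ R h (Set.Ioi (ENNReal.ofReal t)) ≤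
              ENNReal.ofReal (min 1 (Real.pi ^ 2 * R / (8 * v * t)) + ε) ∧
          MobileNetwork.meetingProb n L v τ R h (Set.Ici (ENNReal.ofReal t)) ≤
              ENNReal.ofReal (min 1 (Real.pi ^ 2 * R / (8 * v * t)) + ε) := by
  have h0 : 0 < 8 * R / ε := by positivity
  refine ⟨4 * R + 8 * R / ε, by positivity, fun L hL n hn τ hτ h hh => ⟨?_, ?_, fun t ht => ?_⟩⟩
  · exact MobileNetwork.expectedMeetings_univ_ne_zero hn hv hR hτ hh (by linarith)
  · exact MobileNetwork.expectedMeetings_ne_top n (by linarith) v hτ hh.le R _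
  · have hle := MobileNetwork.meetingProb_Ici_le n hv hR hε hτ hh ht hL
    refine ⟨le_trans ?_ hle, hle⟩
    exact ENNReal.div_le_div_right
      (MobileNetwork.expectedMeetings_mono n L v τ R h Set.Ioi_subset_Ici_self) _
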